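/- **Theorem 7.1.** Let $t>0$. Let $\Delta$ be the set of sequences $\alpha=(\alpha_1\ge\alpha_2\ge\dots\ge0)$ with $\sum_i\alpha_i\le1$, with the topology of coordinatewise convergence and its Borel $\sigma$-algebra, and put $\gamma=\gamma(\alpha)=1-\sum_i\alpha_i$. For an element $f$ of the algebra of symmetric functions $\Lambda=\mathbb R[p_1,p_2,\dots]$ ($p_k$ the power sums) let $\tilde f(\alpha)$ be its image under the algebra morphism $p_1\mapsto\sum_i\alpha_i+\gamma=1$, $p_k\mapsto\sum_i\alpha_i^k$ $(k\ge2)$. Let $PD(t)$ be the Poisson--Dirichlet distribution, i.e. the probability measure $P$ on $\Delta$ such that $$\int_\Delta\tilde m_\lambda(\alpha)\,P(d\alpha)=\frac{M^{(t)}(\lambda)}{\dim_0\lambda}\quad\text{for all partitions }\lambda,\qquad M^{(t)}(\lambda)=\frac{t^{\ell(\lambda)}\,|\lambda|!}{t(t+1)\cdots(t+|\lambda|-1)\,z_\lambda},\qquad z_\lambda=\prod_i\lambda_i\cdot\prod_k r_k(\lambda)!;$$ such a measure exists and is unique. Here $m_\lambda$ is the monomial symmetric function, $\ell(\lambda)$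 is the number of parts of $\lambda$, $r_k(\lambda)$ is the number of parts equal to $k$, and $\dim_0\lambda$ is the number of oriented paths from $\varnothing$ to $\lambda$ in the Kingman graph, where the edge from $\mu$ to $\lambda$ (with $\lambda$ obtained from $\mu$ by replacing one part $k-1$ by $k$, or by adding a part $1$ if $k=1$) has multiplicity $r_k(\lambda)$. For $n\ge1$ let $$\sigma^{(t)}_n=\int_\Delta\underbrace{\nu_\alpha\times\dots\times\nu_\alpha}_{n}\;PD(t)(d\alpha),\qquad \nu_\alpha=\sum_i\alpha_i\,\delta(\alpha_i)+\gamma\,\delta(0),$$ be the $n$-th controlling measure of $PD(t)$ (a probability measure on $[0,1]^n$). Let $\Pi(n,r)$ be the set of partitions of $\{1,\dots,n\}$ into $r$ nonempty blocks. For $\pi\in\Pi(n,r)$ with blocks enumerated in any way as $\pi_1,\dots,\pi_r$, let $\sigma^{(t)}_{n,r,\pi}$ be the image of the measure $$t^r\prod_{i=1}^r y_i^{|\pi_i|-1}\cdot\Bigl(1-\sum_{i=1}^r y_i\Bigr)_+^{t-1}\,dy\quad\text{on }[0,1]^r$$ (where $u_+^{s}=u^{s}$ for $u>0$ and $u_+^s=0$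 for $u\le0$) under the map $y\mapsto x$, $x_j=y_i$ for $j\in\pi_i$, which is a bijection of $[0,1]^r$ onto the diagonal section $\{x\in[0,1]^n: x_j=x_k\text{ whenever } j,k\text{ lie in the same block of }\pi\}$; it does not depend on the enumeration. Then $$\sigma^{(t)}_n=\sum_{r=1}^n\ \sum_{\pi\in\Pi(n,r)}\sigma^{(t)}_{n,r,\pi}.$$ -/

import Mathlib

open MeasureTheory

namespace PoissonDirichlet

/-! ### The simplex, extended power sums, monomial symmetric functions -/

/-- The simplex `Δ` of sequences `α₁ ≥ α₂ ≥ … ≥ 0` with `∑ αᵢ ≤ 1` (indexed from `0` here).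
As a subtype of `ℕ → ℝ` it carries the topology of coordinatewise convergence and the
σ-algebra generated by the coordinates. -/
def simplex : Set (ℕ → ℝ) :=
  {α | Antitone α ∧ (∀ i, 0 ≤ α i) ∧ Summable α ∧ ∑' i, α i ≤ 1}

/-- The defect `γ = 1 - ∑ αᵢ`. -/
noncomputable def gam (α : simplex) : ℝ := 1 - ∑' i, α.1 i

/-- The extended power sums: `p̃₁ = ∑ αᵢ + γ`, and `p̃ₖ = ∑ αᵢ ^ k` for `k ≥ 2`. -/
noncomputable def extPowerSum (α : simplex) (k : ℕ+) : ℝ :=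
  if k = 1 then ∑' i, α.1 i + gam α else ∑' i, α.1 i ^ (k : ℕ)

/-- The algebra of symmetric functions over `ℝ`, that is, `ℝ[p₁, p₂, …]`. -/
abbrev SymFun : Type := MvPolynomial ℕ+ ℝ

/-- The specialization `f ↦ f̃(α)`: the algebra morphism sending `pₖ` to `p̃ₖ(α)`. -/
noncomputable def specialize (α : simplex) (f : SymFun) : ℝ :=
  MvPolynomial.aeval (extPowerSum α) f

/-- The symmetric function `f` is the monomial symmetric function `m_lam`: for every `N`, the
substitution `pₖ ↦ x₁ ^ k + ⋯ + x_N ^ k` turns `f` into the sum of all distinct monomials obtained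
from `x ^ lam` by permuting the variables `x₁, …, x_N`. -/
def IsMonomialSymm {n : ℕ} (lam : n.Partition) (f : SymFun) : Prop :=
  ∀ N : ℕ, MvPolynomial.aeval (fun k : ℕ+ => MvPolynomial.psum (Fin N) ℝ (k : ℕ)) f
    = MvPolynomial.msymm (Fin N) ℝ lam

/-! ### The Kingman graph and the Ewens partition structures -/

/-- The multiplicity `κ₀(mu, lam)` of the edge from `mu` to `lam` in the Kingman graph. If `lam` is
obtained from `mu` by replacing one part `k - 1` by `k` (by adding a new part `1` when `k = 1`),
it is the multiplicity of the part `k` in `lam`; otherwise it is `0`. At most one `k` contributes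
to the sum. -/
def edgeMult {n : ℕ} (mu : n.Partition) (lam : (n + 1).Partition) : ℕ :=
  ∑ k ∈ lam.parts.toFinset,
    if (if k = 1 then lam.parts.erase k else (k - 1) ::ₘ lam.parts.erase k) = mu.parts
    then lam.parts.count k else 0

/-- `dim₀ lam`: the number of oriented paths from the empty partition to `lam` in the Kingman graph,
counted with edge multiplicities. -/
def dimKingman : (n : ℕ) → n.Partition → ℕ
  | 0, _ => 1
  | n + 1, lam => ∑ mu : n.Partition, dimKingman n mu * edgeMult mu lam

/-- `z_lam = ∏ lamᵢ · ∏ₖ rₖ(lam)!`, where `rₖ(lam)` is the multiplicity of the part `k`. -/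
def zee {n : ℕ} (lam : n.Partition) : ℕ :=
  lam.parts.prod * ∏ k ∈ lam.parts.toFinset, (lam.parts.count k).factorial

/-- The Ewens partition structure `M⁽ᵗ⁾ₙ(lam) = t ^ ℓ(lam) · n! / ((t)ₙ · z_lam)`. -/
noncomputable def ewens (t : ℝ) {n : ℕ} (lam : n.Partition) : ℝ :=
  t ^ lam.parts.card * n.factorial / ((ascPochhammer ℝ n).eval t * zee lam)

/-- `P` is the Poisson--Dirichlet distribution `PD(t)`: the probability measure on the simplex
that corresponds to the coherent system `M⁽ᵗ⁾` on the Kingman graph, that is,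
`∫ m̃_lam dP = M⁽ᵗ⁾(lam) / dim₀ lam` for all partitions `lam`. -/
structure IsPoissonDirichlet (t : ℝ) (P : Measure simplex) : Prop where
  isProbabilityMeasure : IsProbabilityMeasure P
  integral_monomial : ∀ (n : ℕ) (lam : n.Partition) (f : SymFun), IsMonomialSymm lam f →
    ∫ α, specialize α f ∂P = ewens t lam / dimKingman n lam

/-! ### Controlling measures -/

/-- The Thoma measure `ν_α = ∑ αᵢ δ(αᵢ) + γ δ(0)`. -/
noncomputable def thomaMeasure (α : simplex) : Measure ℝ :=
  Measure.sum (fun i => ENNReal.ofReal (α.1 i) • Measure.dirac (α.1 i))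
    + ENNReal.ofReal (gam α) • Measure.dirac 0

/-- The `n`-th controlling measure `σₙ = ∫ ν_α × ⋯ × ν_α P(dα)` (`n` factors). It is a measure
on `ℝⁿ` concentrated on the cube `[0,1]ⁿ`. -/
noncomputable def controllingMeasure (P : Measure simplex) (n : ℕ) : Measure (Fin n → ℝ) :=
  P.bind (fun α => Measure.pi (fun _ : Fin n => thomaMeasure α))

/-! ### The measures attached to set partitions -/

/-- `Π(n, r)`: partitions of an `n`-element set into `r` nonempty blocks. -/
abbrev SetPartition (n r : ℕ) : Type :=
  {π : Finpartition (Finset.univ : Finset (Fin n)) // π.parts.card = r}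

/-- The enumerations of the blocks of `π`. A partition with such an enumeration is an ordered
partition. -/
abbrev SetPartition.Enumeration {n r : ℕ} (π : SetPartition n r) : Type :=
  Fin r ≃ {B : Finset (Fin n) // B ∈ π.1.parts}

/-- The index of the block that contains `j`. -/
def SetPartition.blockIndex {n r : ℕ} {π : SetPartition n r} (e : π.Enumeration) (j : Fin n) :
    Fin r :=
  e.symm ⟨π.1.part j, π.1.part_mem.2 (Finset.mem_univ j)⟩

/-- The power `u₊ ^ s`, equal to `u ^ s` for `u > 0` and to `0` for `u ≤ 0` (also when `s = 0`). -/
noncomputable def posPow (u s : ℝ) : ℝ := if 0 < u then u ^ s else 0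

/-- The measure `t ^ r ∏ yᵢ ^ (|πᵢ| - 1) (1 - ∑ yᵢ)₊ ^ (t - 1) dy` on the cube `[0,1]ʳ`, where `πᵢ`
is the `i`-th block (blocks are nonempty, so `|πᵢ| - 1` is a true subtraction). -/
noncomputable def dirichletTypeMeasure (t : ℝ) {n r : ℕ} {π : SetPartition n r}
    (e : π.Enumeration) : Measure (Fin r → ℝ) :=
  (volume.restrict (Set.Icc 0 1)).withDensity fun y =>
    ENNReal.ofReal (t ^ r * (∏ i, y i ^ ((e i).1.card - 1)) * posPow (1 - ∑ i, y i) (t - 1))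

/-- The image of `dirichletTypeMeasure` under the bijection `y ↦ x` from `[0,1]ʳ` onto the diagonal
section of `[0,1]ⁿ` given by `π`, where `xⱼ = yᵢ` if `j` is in the `i`-th block. -/
noncomputable def sectionMeasure (t : ℝ) {n r : ℕ} {π : SetPartition n r}
    (e : π.Enumeration) : Measure (Fin n → ℝ) :=
  (dirichletTypeMeasure t e).map fun y j => y (SetPartition.blockIndex e j)

end PoissonDirichlet

/-! Identity. Both sides are finite measures carried by the cube, so they agree as soon as their
mixed moments do. Under `ν_α` the moment of order `a` is `p̃_{a+1}(α)`: the weight `αᵢ` of the atom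
`αᵢ` raises the exponent by one, and the atom at `0` is seen only for `a = 0`, where it supplies the
defect in `p̃₁`. The mixed moment of the controlling measure is therefore `∫ ∏ⱼ p̃_{aⱼ+1} dP`.
Expanding a product of power sums and grouping index functions by their level sets gives one
augmented monomial (a sum over injections) for each set partition `π`, with exponents `k_B = ∑_{j ∈
B} (aⱼ + 1)` (`prod_sum_pow_eq_sum_augSum`). An augmented monomial is `∏ rₖ!` times a monomial
function, and `dim₀ lam = n! / ∏ lamᵢ!`, so its integral is `t^ℓ ∏ (k_B - 1)! / (t)_{∑ k_B}`, the
quantity `augMoment`. The measure attached to `π` has exactly this moment, by the Dirichlet integral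
(`lintegral_sectionMeasure`). The two sides thus match partition by partition.

Uniqueness. Products of power sums span the symmetric functions, so all integrals `∫ f̃ dP` are
prescribed. The functions `p̃ₖ` are continuous on the compact simplex and separate its points, and
Stone–Weierstrass applies (`ext_of_integral_specialize`).

Existence. Break a unit stick with independent Beta(1, t) fractions. Splitting off the first piece
expresses the mean of an augmented monomial through itself and shorter ones; the recursion is solved
by `augMoment` (`integral_seqEval_sticks`). The pieces have total length one almost surely, so their
decreasing rearrangement has no defect and its law has the required moments. -/

set_option linter.unusedSectionVars false

namespace PoissonDirichlet

/-! ### Sums over functions grouped by their kernels -/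

section Kernels

variable {ι : Type*} [Fintype ι] [DecidableEq ι]

/-- The block of `π` that contains `j`. -/
def block (π : Finpartition (Finset.univ : Finset ι)) (j : ι) : {B : Finset ι // B ∈ π.parts} :=
  ⟨π.part j, π.part_mem.2 (Finset.mem_univ j)⟩

lemma block_eq_iff (π : Finpartition (Finset.univ : Finset ι)) (j : ι)
    (B : {B : Finset ι // B ∈ π.parts}) : block π j = B ↔ j ∈ B.1 := by
  rw [← π.part_eq_iff_mem B.2, ← Subtype.coe_inj, block]

lemma block_surjective (π : Finpartition (Finset.univ : Finset ι)) :
    Function.Surjective (block π) := fun B => by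
  obtain ⟨j, hj⟩ := π.nonempty_of_mem_parts B.2
  exact ⟨j, (block_eq_iff π j B).2 hj⟩

lemma finpartition_ext_part {π ρ : Finpartition (Finset.univ : Finset ι)}
    (h : ∀ i j, block π i = block π j ↔ block ρ i = block ρ j) : π = ρ := by
  have key : ∀ j, π.part j = ρ.part j := fun j => by
    ext i
    have h1 := block_eq_iff π i (block π j)
    have h2 := block_eq_iff ρ i (block ρ j)
    rw [h, h2] at h1
    exact h1.symm
  ext B
  constructor
  · intro hB
    obtain ⟨j, hj⟩ := π.nonempty_of_mem_parts hB
    rw [← π.part_eq_of_mem hB hj, key]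
    exact ρ.part_mem.2 (Finset.mem_univ j)
  · intro hB
    obtain ⟨j, hj⟩ := ρ.nonempty_of_mem_parts hB
    rw [← ρ.part_eq_of_mem hB hj, ← key]
    exact π.part_mem.2 (Finset.mem_univ j)

/-- A sum over all functions splits according to the partition into level sets. -/
lemma sum_eq_sum_finpartition {X R : Type*} [Fintype X] [DecidableEq X] [AddCommMonoid R]
    (F : (ι → X) → R) :
    ∑ f, F f = ∑ π : Finpartition (Finset.univ : Finset ι),
      ∑ g : {B : Finset ι // B ∈ π.parts} ↪ X, F (fun j => g (block π j)) := by
  rw [Finset.sum_sigma']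
  symm
  refine Finset.sum_bij (fun p _ => fun j => p.2 (block p.1 j)) (by simp) ?_ ?_ (by simp)
  · rintro ⟨π, g⟩ - ⟨ρ, h⟩ - hgh
    dsimp only at hgh
    have : π = ρ := finpartition_ext_part fun i j => by
      rw [← g.injective.eq_iff, ← h.injective.eq_iff]
      rw [show g (block π i) = h (block ρ i) from congrFun hgh i,
        show g (block π j) = h (block ρ j) from congrFun hgh j]
    subst this
    congr 1
    ext B
    obtain ⟨j, rfl⟩ := block_surjective π B
    exact congrFun hgh j
  · intro f _
    -- Surjectivity: `f` comes from its kernel partition, with each block sent to the value of `f`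
    -- at a chosen representative.
    let π := Finpartition.ofSetoid (Setoid.ker f)
    have hπ : ∀ i j, block π i = block π j ↔ f i = f j := fun i j => by
      rw [block_eq_iff]
      change i ∈ π.part j ↔ _
      rw [Finpartition.mem_part_ofSetoid_iff_rel]
      exact eq_comm
    let σ := Function.surjInv (block_surjective π)
    have hσ : ∀ B, block π (σ B) = B := Function.surjInv_eq _
    refine ⟨⟨π, ⟨fun B => f (σ B), fun B C hBC => ?_⟩⟩, Finset.mem_univ _, ?_⟩
    · have := (hπ _ _).2 hBC
      rwa [hσ, hσ] at this
    · funext j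
      exact (hπ _ _).1 (hσ _)

lemma prod_comp_block {M : Type*} [CommMonoid M] (π : Finpartition (Finset.univ : Finset ι))
    (y : {B : Finset ι // B ∈ π.parts} → M) (k : ι → ℕ) :
    ∏ j, y (block π j) ^ k j = ∏ B, y B ^ ∑ j ∈ B.1, k j := by
  rw [← Finset.prod_fiberwise Finset.univ (block π)]
  refine Finset.prod_congr rfl fun B _ => ?_
  have : Finset.univ.filter (fun j => block π j = B) = B.1 := by
    ext j; simp [block_eq_iff]
  rw [this, ← Finset.prod_pow_eq_pow_sum]
  exact Finset.prod_congr rfl fun j hj => by rw [(block_eq_iff π j B).2 hj]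

end Kernels

/-! ### Augmented monomial symmetric functions -/

/-- The augmented monomial `∑ x_{g i}^{k i}`, the sum over all injections `g` of the index set. -/
noncomputable def augSum {ι X R : Type*} [Fintype ι] [DecidableEq ι] [Fintype X] [DecidableEq X]
    [CommSemiring R] (k : ι → ℕ) (x : X → R) : R :=
  ∑ g : ι ↪ X, ∏ i, x (g i) ^ k i

/-- The substitution `pₖ ↦ x₁ ^ k + ⋯ + x_N ^ k`. -/
noncomputable def toPoly (N : ℕ) : SymFun →ₐ[ℝ] MvPolynomial (Fin N) ℝ :=
  MvPolynomial.aeval (fun k : ℕ+ => MvPolynomial.psum (Fin N) ℝ (k : ℕ))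

/-- The power sum `pₖ`, for `k > 0`. -/
noncomputable def powerSum (k : ℕ) : SymFun := MvPolynomial.X k.toPNat'

/-- The symmetric function `f` is the augmented monomial symmetric function with exponents `k`. -/
def IsAugmentedMonomial {ι : Type*} [Fintype ι] [DecidableEq ι] (k : ι → ℕ) (f : SymFun) : Prop :=
  ∀ N : ℕ, toPoly N f = augSum k (MvPolynomial.X : Fin N → MvPolynomial (Fin N) ℝ)

lemma toPoly_powerSum {k : ℕ} (hk : 0 < k) (N : ℕ) : toPoly N (powerSum k) =
    ∑ i : Fin N, (MvPolynomial.X i : MvPolynomial (Fin N) ℝ) ^ k := by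
  rw [toPoly, powerSum, MvPolynomial.aeval_X, MvPolynomial.psum, Nat.toPNat'_coe, if_pos hk]

section Augmented

variable {ι : Type*} [Fintype ι] [DecidableEq ι]

/-- Expanding the product gives a sum over all functions from exponents to variables; those with
level sets `π` are the injections of the blocks of `π`. -/
lemma prod_sum_pow_eq_sum_augSum {X R : Type*} [Fintype X] [DecidableEq X] [CommSemiring R]
    (k : ι → ℕ) (x : X → R) :
    ∏ j, ∑ i, x i ^ k j = ∑ π : Finpartition (Finset.univ : Finset ι),
      augSum (fun B : {B : Finset ι // B ∈ π.parts} => ∑ j ∈ B.1, k j) x := by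
  rw [Finset.prod_univ_sum, Fintype.piFinset_univ, sum_eq_sum_finpartition]
  refine Finset.sum_congr rfl fun π _ => Finset.sum_congr rfl fun g _ => ?_
  exact prod_comp_block π (fun B => x (g B)) k

lemma augSum_equiv {κ X R : Type*} [Fintype κ] [DecidableEq κ] [Fintype X] [DecidableEq X]
    [CommSemiring R] (e : ι ≃ κ) (k : κ → ℕ) (x : X → R) :
    augSum (k ∘ e) x = augSum k x := by
  unfold augSum
  refine Fintype.sum_equiv (Equiv.embeddingCongr e (Equiv.refl X)) _ _ fun g => ?_
  refine Fintype.prod_equiv e _ _ fun i => ?_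
  simp

/-- Blocks of the discrete partition are the points. -/
noncomputable def botEquiv (ι : Type*) [Fintype ι] [DecidableEq ι] :
    ι ≃ {B : Finset ι // B ∈ (⊥ : Finpartition (Finset.univ : Finset ι)).parts} :=
  Equiv.ofBijective (fun j => ⟨{j}, Finpartition.mem_bot_iff.2 ⟨j, Finset.mem_univ j, rfl⟩⟩)
    ⟨fun i j h => by simpa using h, fun ⟨B, hB⟩ => by
      obtain ⟨j, -, rfl⟩ := Finpartition.mem_bot_iff.1 hB
      exact ⟨j, rfl⟩⟩

lemma augSum_bot {X R : Type*} [Fintype X] [DecidableEq X] [CommSemiring R]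
    (k : ι → ℕ) (x : X → R) :
    augSum (fun B : {B : Finset ι // B ∈ (⊥ : Finpartition (Finset.univ : Finset ι)).parts} =>
      ∑ j ∈ B.1, k j) x = augSum k x := by
  rw [← augSum_equiv (botEquiv ι)]
  congr 1

/-- The decrease behind the induction that constructs augmented monomials: with as many blocks as
points, `block` would be a bijection. -/
lemma card_parts_lt_of_ne_bot {π : Finpartition (Finset.univ : Finset ι)} (h : π ≠ ⊥) :
    Fintype.card {B : Finset ι // B ∈ π.parts} < Fintype.card ι := by
  by_contra hlt
  apply h
  have hle := Fintype.card_le_of_surjective _ (block_surjective π)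
  have hbij := (Fintype.bijective_iff_surjective_and_card (block π)).2
    ⟨block_surjective π, le_antisymm (not_lt.1 hlt) hle⟩
  have hb := Fintype.bijective_iff_surjective_and_card
    (block (⊥ : Finpartition (Finset.univ : Finset ι))) |>.2
    ⟨block_surjective _, Fintype.card_congr (botEquiv ι)⟩
  exact finpartition_ext_part fun i j => by rw [hbij.1.eq_iff, hb.1.eq_iff]

lemma blockSum_pos (π : Finpartition (Finset.univ : Finset ι)) {k : ι → ℕ} (hk : ∀ i, 0 < k i)
    (B : {B : Finset ι // B ∈ π.parts}) : 0 < ∑ j ∈ B.1, k j :=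
  Finset.sum_pos (fun j _ => hk j) (π.nonempty_of_mem_parts B.2)

end Augmented

/-- In the expansion of `∏ pₖ` the discrete partition contributes the augmented monomial itself and
every other partition one with fewer exponents, so the equation can be solved for it. The index type
varies because the recursion passes to blocks. -/
lemma exists_isAugmentedMonomial_aux (n : ℕ) : ∀ (ι : Type) [Fintype ι] [DecidableEq ι]
    (k : ι → ℕ), (∀ i, 0 < k i) → Fintype.card ι = n → ∃ f, IsAugmentedMonomial k f := by
  induction n using Nat.strong_induction_on with
  | _ n ih =>
    intro ι _ _ k hk hn
    have H : ∀ π : Finpartition (Finset.univ : Finset ι), ∃ f : SymFun, π ≠ ⊥ →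
        IsAugmentedMonomial (fun B : {B : Finset ι // B ∈ π.parts} => ∑ j ∈ B.1, k j) f := by
      intro π
      by_cases h : π = ⊥
      · exact ⟨0, fun h' => absurd h h'⟩
      · obtain ⟨f, hf⟩ := ih _ (hn ▸ card_parts_lt_of_ne_bot h) {B : Finset ι // B ∈ π.parts}
          (fun B => ∑ j ∈ B.1, k j) (blockSum_pos π hk) rfl
        exact ⟨f, fun _ => hf⟩
    choose F hF using H
    refine ⟨∏ j, powerSum (k j) - ∑ π ∈ Finset.univ.erase ⊥, F π, fun N => ?_⟩
    simp only [map_sub, map_prod, toPoly_powerSum (hk _)]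
    rw [prod_sum_pow_eq_sum_augSum, map_sum,
      ← Finset.add_sum_erase _ _ (Finset.mem_univ (⊥ : Finpartition (Finset.univ : Finset ι))),
      augSum_bot, add_sub_assoc, add_eq_left, sub_eq_zero]
    exact Finset.sum_congr rfl fun π hπ => (hF π (Finset.ne_of_mem_erase hπ) N).symm

lemma exists_isAugmentedMonomial {ι : Type} [Fintype ι] [DecidableEq ι] (k : ι → ℕ)
    (hk : ∀ i, 0 < k i) : ∃ f, IsAugmentedMonomial k f :=
  exists_isAugmentedMonomial_aux _ ι k hk rfl

/-! ### Monomial symmetric functions and their augmented versions -/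

section Monomial

variable {ι : Type*} [Fintype ι] [DecidableEq ι] {σ : Type*} [Fintype σ] [DecidableEq σ]

/-- The multiset that contains `g i` with multiplicity `k i`. -/
def weightedImage (k : ι → ℕ) (g : ι ↪ σ) : Multiset σ :=
  ∑ i, Multiset.replicate (k i) (g i)

lemma card_weightedImage (k : ι → ℕ) (g : ι ↪ σ) : (weightedImage k g).card = ∑ i, k i := by
  simp [weightedImage]

lemma count_weightedImage (k : ι → ℕ) (g : ι ↪ σ) (i : ι) :
    (weightedImage k g).count (g i) = k i := by
  simp [weightedImage, Multiset.count_sum', Multiset.count_replicate, g.injective.eq_iff]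

lemma dedup_weightedImage {k : ι → ℕ} (hk : ∀ i, 0 < k i) (g : ι ↪ σ) :
    (weightedImage k g).dedup = Finset.univ.val.map g := by
  refine (Multiset.Nodup.ext (Multiset.nodup_dedup _)
    (Finset.univ.nodup.map g.injective)).2 fun x => ?_
  rw [Multiset.mem_dedup, weightedImage, Multiset.mem_sum]
  simp only [Finset.mem_univ, true_and, Multiset.mem_replicate, Multiset.mem_map, Finset.mem_val]
  exact ⟨fun ⟨i, _, h⟩ => ⟨i, h.symm⟩, fun ⟨i, h⟩ => ⟨i, (hk i).ne', h.symm⟩⟩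

lemma prod_map_weightedImage {R : Type*} [CommSemiring R] (k : ι → ℕ) (g : ι ↪ σ) (x : σ → R) :
    ((weightedImage k g).map x).prod = ∏ i, x (g i) ^ k i := by
  rw [weightedImage, ← Multiset.coe_mapAddMonoidHom, map_sum, Multiset.prod_sum]
  simp

/-- Counts need checking only on the range of `g`: this already gives an inclusion of multisets, and
equal cardinality turns it into an equality. -/
lemma weightedImage_eq_iff {k : ι → ℕ} (g : ι ↪ σ) {s : Multiset σ} (hs : s.card = ∑ i, k i) :
    weightedImage k g = s ↔ ∀ i, s.count (g i) = k i := by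
  constructor
  · rintro rfl i
    exact count_weightedImage k g i
  · intro h
    refine Multiset.eq_of_le_of_card_le (Multiset.le_iff_count.2 fun x => ?_)
      (by rw [card_weightedImage, hs])
    by_cases hx : ∃ i, g i = x
    · obtain ⟨i, rfl⟩ := hx
      rw [count_weightedImage, h]
    · rw [weightedImage, Multiset.count_sum']
      simp only [Multiset.count_replicate]
      rw [Finset.sum_eq_zero fun i _ => if_neg fun h' => hx ⟨i, h'⟩]
      exact Nat.zero_le _

lemma count_map_univ {τ : Type*} [Fintype τ] (k : τ → ℕ) (c : ℕ) :
    (Finset.univ.val.map k).count c = Fintype.card {i // k i = c} := by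
  rw [Multiset.count_map, Fintype.card_subtype, Finset.card_def, Finset.filter_val]
  simp only [eq_comm]

/-- The number of injections with prescribed weighted image is the number of permutations of the
index set that preserve the weights. -/
lemma card_weightedImage_eq {k : ι → ℕ} (hk : ∀ i, 0 < k i) {s : Multiset σ}
    (hs : s.dedup.map s.count = Finset.univ.val.map k) :
    (Finset.univ.filter fun g : ι ↪ σ => weightedImage k g = s).card =
      ∏ c ∈ Finset.univ.image k, ((Finset.univ.val.map k).count c).factorial := by
  have hcard : s.card = ∑ i, k i := by
    have h := congrArg Multiset.sum hs
    rw [← Finset.sum_eq_multiset_sum] at h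
    rw [← h, ← Multiset.toFinset_val, ← Finset.sum_eq_multiset_sum, Multiset.toFinset_sum_count_eq]
  let τ := {x // x ∈ s.toFinset}
  let κ : τ → ℕ := fun x => s.count x.1
  have hκ : Finset.univ.val.map κ = Finset.univ.val.map k := by
    have h : s.dedup = Finset.univ.val.map (Subtype.val : τ → σ) :=
      (congrArg Finset.val (Finset.attach_map_val (s := s.toFinset))).symm
    rw [← hs, h, Multiset.map_map]
    rfl
  have hfib : ∀ c, Nonempty ({i // k i = c} ≃ {x // κ x = c}) := fun c => by
    rw [← Fintype.card_eq, ← count_map_univ, ← count_map_univ, hκ]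
  -- One admissible injection, glued from bijections between the level sets of the weights. Every
  -- other one is `e₀` after a unique permutation in the stabilizer of `k`, whose order is the
  -- product of factorials.
  let e₀ : ι ≃ τ := Equiv.ofFiberEquiv fun c => (hfib c).some
  have he₀ : ∀ i, κ (e₀ i) = k i := Equiv.ofFiberEquiv_map _
  simp only [count_map_univ]
  rw [← DomMulAct.stabilizer_card', ← Fintype.card_subtype]
  refine (Fintype.card_congr (Equiv.ofBijective
    (fun p : {p : Equiv.Perm ι // k ∘ p = k} =>
      (⟨(p.1.trans e₀).toEmbedding.trans (Function.Embedding.subtype _), ?_⟩ :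
        {g : ι ↪ σ // weightedImage k g = s})) ⟨?_, ?_⟩)).symm
  · rw [weightedImage_eq_iff _ hcard]
    intro i
    exact (he₀ (p.1 i)).trans (congrFun p.2 i)
  · rintro ⟨p, hp⟩ ⟨q, hq⟩ h
    ext i
    have := DFunLike.congr_fun (Subtype.ext_iff.1 h) i
    exact e₀.injective (Subtype.ext this)
  · rintro ⟨g, hg⟩
    have hc := (weightedImage_eq_iff g hcard).1 hg
    have hmem : ∀ i, g i ∈ s.toFinset := fun i => by
      rw [Multiset.mem_toFinset, ← Multiset.count_pos, hc]; exact hk i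
    let p : ι → ι := fun i => e₀.symm ⟨g i, hmem i⟩
    have hp : Function.Injective p := fun i j h =>
      g.injective (Subtype.ext_iff.1 (e₀.symm.injective h))
    refine ⟨⟨Equiv.ofBijective p (Finite.injective_iff_bijective.1 hp), ?_⟩, ?_⟩
    · funext i
      change k (e₀.symm ⟨g i, hmem i⟩) = k i
      rw [← he₀, Equiv.apply_symm_apply]
      exact hc i
    · apply Subtype.ext
      ext i
      change (e₀ (e₀.symm ⟨g i, hmem i⟩)).1 = g i
      rw [Equiv.apply_symm_apply]

/-- Injections are grouped by the monomial they produce; each monomial of type `lam` arises from `∏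
rₖ!` of them. -/
lemma augSum_X_eq_smul_msymm {n : ℕ} {lam : n.Partition} {k : ι → ℕ}
    (hlam : Finset.univ.val.map k = lam.parts) :
    augSum k (MvPolynomial.X : σ → MvPolynomial σ ℝ) =
      ((∏ c ∈ lam.parts.toFinset, (lam.parts.count c).factorial : ℕ) : ℝ) •
        MvPolynomial.msymm σ ℝ lam := by
  have hk : ∀ i, 0 < k i := fun i =>
    lam.parts_pos (hlam ▸ Multiset.mem_map_of_mem k (Finset.mem_univ i))
  have hsum : ∑ i, k i = n := by
    rw [Finset.sum_eq_multiset_sum, hlam, lam.parts_sum]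
  let S : (ι ↪ σ) → {a : Sym σ n // Nat.Partition.ofSym a = lam} := fun g =>
    ⟨⟨weightedImage k g, by rw [card_weightedImage, hsum]⟩, by
      ext1
      change (weightedImage k g).dedup.map (weightedImage k g).count = _
      rw [dedup_weightedImage hk, Multiset.map_map, ← hlam]
      exact Multiset.map_congr rfl fun i _ => count_weightedImage k g i⟩
  unfold augSum MvPolynomial.msymm
  rw [← Finset.sum_fiberwise Finset.univ S, Finset.smul_sum]
  refine Finset.sum_congr rfl fun s _ => ?_
  have hs : s.1.1.dedup.map s.1.1.count = Finset.univ.val.map k := by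
    rw [hlam]; exact congrArg Nat.Partition.parts s.2
  have hfil : (Finset.univ.filter fun g => S g = s) =
      Finset.univ.filter fun g : ι ↪ σ => weightedImage k g = s.1.1 := by
    ext g
    simp only [Finset.mem_filter, Finset.mem_univ, true_and]
    exact ⟨fun h => congrArg (fun a => a.1.1) h, fun h => Subtype.ext (Subtype.ext h)⟩
  have himg : Finset.univ.image k = lam.parts.toFinset := by
    rw [← hlam]; ext; simp
  rw [hfil, Finset.sum_congr rfl (g := fun _ => (s.1.1.map MvPolynomial.X).prod), Finset.sum_const,
    card_weightedImage_eq hk hs, hlam, himg]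
  · exact (Nat.cast_smul_eq_nsmul ℝ _ _).symm
  · intro g hg
    rw [← (Finset.mem_filter.1 hg).2, prod_map_weightedImage]

end Monomial

/-! ### The dimension in the Kingman graph -/

/-- Lowering a part `k` divides `∏ lamᵢ!` by `k`, so by induction the edge through `k` contributes
`n! · rₖ k`, and `∑ rₖ k = n + 1`. -/
lemma dimKingman_mul_prod_factorial : ∀ (n : ℕ) (lam : n.Partition),
    dimKingman n lam * (lam.parts.map Nat.factorial).prod = n.factorial
  | 0, lam => by
    rw [Subsingleton.elim lam (Nat.Partition.indiscrete 0)]; simp [dimKingman]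
  | n + 1, lam => by
    rw [dimKingman, Finset.sum_mul]
    have hstep : ∀ k ∈ lam.parts.toFinset,
        (∑ mu : n.Partition, dimKingman n mu *
          (if (if k = 1 then lam.parts.erase k else (k - 1) ::ₘ lam.parts.erase k) = mu.parts
            then lam.parts.count k else 0) * (lam.parts.map Nat.factorial).prod) =
          n.factorial * (lam.parts.count k * k) := by
      intro k hk
      rw [Multiset.mem_toFinset] at hk
      have hpos := lam.parts_pos hk
      -- `T` lists the parts of the only predecessor of `lam` that contributes for this `k`.
      obtain ⟨T, hT⟩ : ∃ T, T = if k = 1 then lam.parts.erase k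
          else (k - 1) ::ₘ lam.parts.erase k := ⟨_, rfl⟩
      have hcons := Multiset.cons_erase hk
      have hTsum : T.sum = n := by
        have h1 := lam.parts_sum
        rw [← hcons, Multiset.sum_cons] at h1
        rw [hT]; split_ifs with h
        · omega
        · rw [Multiset.sum_cons]; omega
      have hTpos : ∀ {i}, i ∈ T → 0 < i := by
        intro i hi
        rw [hT] at hi
        split_ifs at hi with h
        · exact lam.parts_pos (Multiset.mem_of_mem_erase hi)
        · rcases Multiset.mem_cons.1 hi with rfl | hi
          · omega
          · exact lam.parts_pos (Multiset.mem_of_mem_erase hi)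
      have hTprod : (lam.parts.map Nat.factorial).prod = k * (T.map Nat.factorial).prod := by
        conv_lhs => rw [← hcons, Multiset.map_cons, Multiset.prod_cons]
        rw [hT]
        split_ifs with h
        · simp [h]
        · rw [Multiset.map_cons, Multiset.prod_cons, ← mul_assoc, Nat.mul_factorial_pred hpos.ne']
      rw [Finset.sum_eq_single (⟨T, hTpos, hTsum⟩ : n.Partition)]
      · rw [if_pos hT.symm, hTprod]
        have ih := dimKingman_mul_prod_factorial n ⟨T, hTpos, hTsum⟩
        rw [← ih]
        ring
      · intro mu _ hmu
        rw [if_neg]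
        · simp
        · intro h
          exact hmu (Nat.Partition.ext (h.symm.trans hT.symm))
      · simp
    simp only [edgeMult, Finset.mul_sum, Finset.sum_mul]
    rw [Finset.sum_comm, Finset.sum_congr rfl hstep, ← Finset.mul_sum]
    have hsum : ∑ k ∈ lam.parts.toFinset, lam.parts.count k * k = n + 1 := by
      have h := Finset.sum_multiset_count lam.parts
      rw [lam.parts_sum] at h
      simpa using h.symm
    rw [hsum, Nat.factorial_succ, mul_comm]

/-- The moments of the Poisson--Dirichlet distribution at augmented monomials. -/
noncomputable def augMoment {ι : Type*} [Fintype ι] (t : ℝ) (k : ι → ℕ) : ℝ :=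
  t ^ Fintype.card ι * (∏ i, ((k i - 1).factorial : ℝ)) / (ascPochhammer ℝ (∑ i, k i)).eval t

/-- The factorials `n!` and `∏ rₖ!` cancel, and `lamᵢ! / lamᵢ = (lamᵢ - 1)!`. -/
lemma augMoment_eq {ι : Type*} [Fintype ι] {t : ℝ} {n : ℕ} {lam : n.Partition} {k : ι → ℕ}
    (hlam : Finset.univ.val.map k = lam.parts) :
    ewens t lam / dimKingman n lam *
      ((∏ c ∈ lam.parts.toFinset, (lam.parts.count c).factorial : ℕ) : ℝ) = augMoment t k := by
  have hk : ∀ i, 0 < k i := fun i =>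
    lam.parts_pos (hlam ▸ Multiset.mem_map_of_mem k (Finset.mem_univ i))
  have hsum : ∑ i, k i = n := by
    rw [Finset.sum_eq_multiset_sum, hlam, lam.parts_sum]
  have hcard : lam.parts.card = Fintype.card ι := by
    rw [← hlam, Multiset.card_map, ← Finset.card_def, Finset.card_univ]
  have hdim := dimKingman_mul_prod_factorial n lam
  have hfac : (lam.parts.map Nat.factorial).prod = lam.parts.prod * ∏ i, (k i - 1).factorial := by
    rw [← hlam, Multiset.map_map]
    change ∏ i, (k i).factorial = (∏ i, k i) * _
    rw [← Finset.prod_mul_distrib]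
    exact Finset.prod_congr rfl fun i _ => (Nat.mul_factorial_pred (hk i).ne').symm
  have hprod : lam.parts.prod ≠ 0 := by
    rw [← hlam]; exact Finset.prod_ne_zero_iff.2 fun i _ => (hk i).ne'
  have hd : dimKingman n lam ≠ 0 := fun h => n.factorial_ne_zero (by rw [← hdim, h, zero_mul])
  have hr : (∏ c ∈ lam.parts.toFinset, (lam.parts.count c).factorial) ≠ 0 :=
    Finset.prod_ne_zero_iff.2 fun _ _ => Nat.factorial_ne_zero _
  rw [augMoment, hsum, ewens, zee, hcard, ← hdim, hfac]
  push_cast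
  have h1 : (lam.parts.prod : ℝ) ≠ 0 := mod_cast hprod
  have h2 : (dimKingman n lam : ℝ) ≠ 0 := mod_cast hd
  have h3 : (∏ c ∈ lam.parts.toFinset, ((lam.parts.count c).factorial : ℝ)) ≠ 0 := mod_cast hr
  -- If the Pochhammer symbol vanishes, both sides are quotients by zero, hence zero; no condition
  -- on `t` is needed.
  by_cases h0 : (ascPochhammer ℝ n).eval t = 0
  · simp [h0]
  · push_cast at h1
    field_simp

open Filter Topology

/-! ### Evaluation of symmetric functions at sequences -/

/-- Sequences of nonnegative numbers with sum at most one. -/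
def subprob : Set (ℕ → ℝ) := {v | (∀ i, 0 ≤ v i) ∧ Summable v ∧ ∑' i, v i ≤ 1}

lemma subprob.le_one {v : ℕ → ℝ} (hv : v ∈ subprob) (i : ℕ) : v i ≤ 1 :=
  (hv.2.1.le_tsum i fun j _ => hv.1 j).trans hv.2.2

lemma subprob.pow_le {v : ℕ → ℝ} (hv : v ∈ subprob) {k : ℕ} (hk : 0 < k) (i : ℕ) :
    v i ^ k ≤ v i :=
  pow_le_of_le_one (hv.1 i) (subprob.le_one hv i) hk.ne'

lemma subprob.summable_pow {v : ℕ → ℝ} (hv : v ∈ subprob) {k : ℕ} (hk : 0 < k) :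
    Summable fun i => v i ^ k :=
  hv.2.1.of_nonneg_of_le (fun i => pow_nonneg (hv.1 i) k) (subprob.pow_le hv hk)

lemma subprob.tsum_pow_le {v : ℕ → ℝ} (hv : v ∈ subprob) {k : ℕ} (hk : 0 < k) :
    ∑' i, v i ^ k ≤ 1 :=
  ((subprob.summable_pow hv hk).tsum_le_tsum (subprob.pow_le hv hk) hv.2.1).trans hv.2.2

lemma subprob.tsum_pow_nonneg {v : ℕ → ℝ} (hv : v ∈ subprob) (k : ℕ) :
    0 ≤ ∑' i, v i ^ k :=
  tsum_nonneg fun i => pow_nonneg (hv.1 i) k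

/-- The value of a symmetric function at a sequence. -/
noncomputable def seqEval (v : ℕ → ℝ) (f : SymFun) : ℝ :=
  MvPolynomial.eval (fun k : ℕ+ => ∑' i, v i ^ (k : ℕ)) f

lemma eval_toPoly {N : ℕ} (x : Fin N → ℝ) (f : SymFun) :
    MvPolynomial.eval x (toPoly N f) = MvPolynomial.eval (fun k : ℕ+ => ∑ i, x i ^ (k : ℕ)) f := by
  have : (MvPolynomial.aeval x).comp (toPoly N) =
      MvPolynomial.aeval (R := ℝ) (fun k : ℕ+ => ∑ i, x i ^ (k : ℕ)) := by
    ext k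
    simp [toPoly, MvPolynomial.psum]
  exact DFunLike.congr_fun this f

lemma specialize_eq_eval (α : simplex) (f : SymFun) :
    specialize α f = MvPolynomial.eval (extPowerSum α) f := rfl

lemma tendsto_eval_toPoly {v : ℕ → ℝ} (hv : v ∈ subprob) (f : SymFun) :
    Tendsto (fun N => MvPolynomial.eval (fun i : Fin N => v i) (toPoly N f)) atTop
      (𝓝 (seqEval v f)) := by
  simp only [eval_toPoly]
  refine ((MvPolynomial.continuous_eval f).tendsto _).comp (tendsto_pi_nhds.2 fun k => ?_)
  simp only [Fin.sum_univ_eq_sum_range (fun i => v i ^ (k : ℕ))]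
  exact (subprob.summable_pow hv k.pos).hasSum.tendsto_sum_nat

lemma eval_augSum {ι : Type*} [Fintype ι] [DecidableEq ι] {k : ι → ℕ} {f : SymFun}
    (h : IsAugmentedMonomial k f) {N : ℕ} (x : Fin N → ℝ) :
    MvPolynomial.eval x (toPoly N f) = augSum k x := by
  rw [h N]
  simp [augSum]

lemma tendsto_augSum {ι : Type*} [Fintype ι] [DecidableEq ι] {k : ι → ℕ} {f : SymFun}
    (h : IsAugmentedMonomial k f) {v : ℕ → ℝ} (hv : v ∈ subprob) :
    Tendsto (fun N => augSum k (fun i : Fin N => v i)) atTop (𝓝 (seqEval v f)) := by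
  simpa only [eval_augSum h] using tendsto_eval_toPoly hv f

/-! ### The simplex -/

lemma extPowerSum_one (α : simplex) : extPowerSum α 1 = 1 := by
  simp [extPowerSum, gam]

lemma extPowerSum_of_ne {k : ℕ+} (hk : k ≠ 1) (α : simplex) :
    extPowerSum α k = ∑' i, α.1 i ^ (k : ℕ) := if_neg hk

lemma gam_nonneg (α : simplex) : 0 ≤ gam α := sub_nonneg.2 α.2.2.2.2

lemma extPowerSum_nonneg (α : simplex) (k : ℕ+) : 0 ≤ extPowerSum α k := by
  by_cases hk : k = 1
  · rw [hk, extPowerSum_one]; exact zero_le_one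
  · rw [extPowerSum_of_ne hk]; exact subprob.tsum_pow_nonneg α.2.2 _

/-- Approximation of a point of the simplex by finite sequences: the remaining mass is spread
evenly over `N + 1` points. -/
noncomputable def finiteApprox (α : simplex) (N : ℕ) : Fin (N + (N + 1)) → ℝ :=
  Fin.append (fun i : Fin N => α.1 i)
    (fun _ : Fin (N + 1) => (1 - ∑ i ∈ Finset.range N, α.1 i) / (N + 1))

lemma sum_finiteApprox_pow (α : simplex) (N k : ℕ) :
    ∑ i, finiteApprox α N i ^ k = ∑ i ∈ Finset.range N, α.1 i ^ k +
      (N + 1) * ((1 - ∑ i ∈ Finset.range N, α.1 i) / (N + 1)) ^ k := by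
  rw [Fin.sum_univ_add]
  simp [finiteApprox, Fin.sum_univ_eq_sum_range (fun i => α.1 i ^ k)]

/-- For `k = 1` the total is exactly one at every stage. For `k ≥ 2` the spread-out mass contributes
at most `1 / (N + 1)`. -/
lemma tendsto_sum_finiteApprox_pow (α : simplex) (k : ℕ+) :
    Tendsto (fun N => ∑ i, finiteApprox α N i ^ (k : ℕ)) atTop (𝓝 (extPowerSum α k)) := by
  simp only [sum_finiteApprox_pow]
  by_cases hk : k = 1
  · subst hk
    rw [extPowerSum_one]
    refine tendsto_const_nhds.congr fun N => ?_
    have : (N : ℝ) + 1 ≠ 0 := by positivity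
    simp only [PNat.one_coe, pow_one]
    field_simp
    ring
  · rw [extPowerSum_of_ne hk]
    have hk2 : 2 ≤ (k : ℕ) := by
      have h1 := k.pos
      have h2 : (k : ℕ) ≠ 1 := fun h => hk (PNat.eq h)
      omega
    rw [← add_zero (∑' i, α.1 i ^ (k : ℕ))]
    refine ((subprob.summable_pow α.2.2 k.pos).hasSum.tendsto_sum_nat).add ?_
    refine squeeze_zero (fun N => ?_) (fun N => ?_) tendsto_one_div_add_atTop_nhds_zero_nat
    · have : 0 ≤ 1 - ∑ i ∈ Finset.range N, α.1 i := sub_nonneg.2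
        ((α.2.2.2.1.sum_le_tsum _ fun i _ => α.2.2.1 i).trans α.2.2.2.2)
      positivity
    · have h0 : 0 ≤ 1 - ∑ i ∈ Finset.range N, α.1 i := sub_nonneg.2
        ((α.2.2.2.1.sum_le_tsum _ fun i _ => α.2.2.1 i).trans α.2.2.2.2)
      have h1 : 1 - ∑ i ∈ Finset.range N, α.1 i ≤ 1 :=
        sub_le_self _ (Finset.sum_nonneg fun i _ => α.2.2.1 i)
      have hN : (0 : ℝ) < N + 1 := by positivity
      set c := (1 - ∑ i ∈ Finset.range N, α.1 i) / ((N : ℝ) + 1) with hc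
      have hc0 : 0 ≤ c := by positivity
      have hcN : c ≤ 1 / (N + 1) := by rw [hc]; gcongr
      have hc1 : c ≤ 1 := hcN.trans (by rw [div_le_one hN]; linarith [Nat.cast_nonneg (α := ℝ) N])
      calc ((N : ℝ) + 1) * c ^ (k : ℕ) ≤ (N + 1) * c ^ 2 := by
            gcongr ?_ * ?_
            exact pow_le_pow_of_le_one hc0 hc1 hk2
        _ ≤ (N + 1) * (1 / (N + 1)) ^ 2 := by gcongr
        _ = 1 / (N + 1) := by field_simp

/-- A specialization is a limit of evaluations at finitely many variables. Hence conditions stated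
only through `toPoly`, such as `IsMonomialSymm`, determine it, although the defect enters `p̃₁`. -/
lemma specialize_congr {f g : SymFun} (h : ∀ N, toPoly N f = toPoly N g) (α : simplex) :
    specialize α f = specialize α g := by
  have key : ∀ f : SymFun, Tendsto
      (fun N => MvPolynomial.eval (finiteApprox α N) (toPoly _ f)) atTop (𝓝 (specialize α f)) := by
    intro f
    simp only [eval_toPoly]
    exact ((MvPolynomial.continuous_eval f).tendsto _).comp
      (tendsto_pi_nhds.2 fun k => tendsto_sum_finiteApprox_pow α k)
  refine tendsto_nhds_unique (key f) ?_
  simp only [h]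
  exact key g

/-- Bounds on partial sums, unlike a bound on the full sum, are visibly closed under coordinatewise
convergence. -/
lemma simplex_eq : simplex = {α | Antitone α} ∩ {α | ∀ i, 0 ≤ α i} ∩
    {α | ∀ N, ∑ i ∈ Finset.range N, α i ≤ 1} := by
  ext α
  constructor
  · rintro ⟨h1, h2, h3, h4⟩
    exact ⟨⟨h1, h2⟩, fun N => (h3.sum_le_tsum _ fun i _ => h2 i).trans h4⟩
  · rintro ⟨⟨h1, h2⟩, h3⟩
    have hs : Summable α := summable_of_sum_range_le h2 h3
    exact ⟨h1, h2, hs, hs.tsum_le_of_sum_range_le h3⟩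

lemma isClosed_simplex : IsClosed simplex := by
  rw [simplex_eq]
  refine (IsClosed.inter ?_ ?_).inter ?_
  · simp only [Antitone, Set.ofPred_forall]
    exact isClosed_iInter fun i => isClosed_iInter fun j => isClosed_iInter fun _ =>
      isClosed_le (continuous_apply j) (continuous_apply i)
  · simp only [Set.ofPred_forall]
    exact isClosed_iInter fun i => isClosed_le continuous_const (continuous_apply i)
  · simp only [Set.ofPred_forall]
    exact isClosed_iInter fun N => isClosed_le
      (continuous_finsetSum _ fun i _ => continuous_apply i) continuous_const

instance compactSpace_simplex : CompactSpace simplex := by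
  refine isCompact_iff_compactSpace.1 (IsCompact.of_isClosed_subset
    (isCompact_univ_pi fun _ : ℕ => isCompact_Icc (a := (0 : ℝ)) (b := 1)) isClosed_simplex ?_)
  exact fun α hα i _ => ⟨hα.2.1 i, subprob.le_one hα.2 i⟩

instance polishSpace_simplex : PolishSpace simplex := isClosed_simplex.polishSpace

lemma simplex_le (α : simplex) (i : ℕ) : α.1 i ≤ 1 / (i + 1) := by
  rw [le_div_iff₀ (by positivity)]
  calc α.1 i * (i + 1) = ∑ _j ∈ Finset.range (i + 1), α.1 i := by simp [mul_comm]
    _ ≤ ∑ j ∈ Finset.range (i + 1), α.1 j := Finset.sum_le_sum fun j hj =>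
        α.2.1 (Nat.lt_succ_iff.1 (Finset.mem_range.1 hj))
    _ ≤ 1 := (α.2.2.2.1.sum_le_tsum _ fun i _ => α.2.2.1 i).trans α.2.2.2.2

/-- Monotonicity gives `αᵢ ≤ 1 / (i + 1)`, so the Weierstrass test applies for `k ≥ 2`. For `k = 1`
continuity fails, since mass can escape; the defect makes `p̃₁` constant instead. -/
lemma continuous_tsum_pow {k : ℕ} (hk : 2 ≤ k) :
    Continuous fun α : simplex => ∑' i, α.1 i ^ k := by
  refine continuous_tsum (u := fun i : ℕ => (1 / ((i : ℝ) + 1)) ^ 2)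
    (fun i => ((continuous_apply i).comp continuous_subtype_val).pow k) ?_ fun i α => ?_
  · have := (summable_nat_add_iff 1).2 (Real.summable_one_div_nat_pow.2 one_lt_two)
    simpa using this
  · rw [Real.norm_of_nonneg (pow_nonneg (α.2.2.1 i) k)]
    calc α.1 i ^ k ≤ α.1 i ^ 2 :=
          pow_le_pow_of_le_one (α.2.2.1 i) (subprob.le_one α.2.2 i) hk
      _ ≤ _ := pow_le_pow_left₀ (α.2.2.1 i) (simplex_le α i) 2

lemma continuous_extPowerSum (k : ℕ+) : Continuous fun α => extPowerSum α k := by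
  by_cases hk : k = 1
  · subst hk
    simp only [extPowerSum_one]
    exact continuous_const
  · simp only [extPowerSum_of_ne hk]
    refine continuous_tsum_pow ?_
    have h1 := k.pos
    have h2 : (k : ℕ) ≠ 1 := fun h => hk (PNat.eq h)
    omega

lemma continuous_specialize (f : SymFun) : Continuous fun α => specialize α f :=
  (MvPolynomial.continuous_eval f).comp (continuous_pi continuous_extPowerSum)

lemma integrable_specialize (P : Measure simplex) [IsFiniteMeasure P] (f : SymFun) :
    Integrable (fun α => specialize α f) P := by
  have h := (continuous_specialize f).continuousOn (s := Set.univ)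
  rw [← integrableOn_univ]
  exact h.integrableOn_compact isCompact_univ

/-- The power sums of degree at least two, as a map from the simplex to sequences. -/
noncomputable def powerMap (α : simplex) (k : ℕ) : ℝ := ∑' i, α.1 i ^ (k + 2)

lemma continuous_powerMap : Continuous powerMap :=
  continuous_pi fun k => continuous_tsum_pow (by omega)

/-- After removal of the common terms, `α_m ^ (j + 2)` is at most the tail of the power sum of `β`,
hence at most `β_m ^ (j + 1)`. If `β_m < α_m`, this fails for large `j`. -/
lemma le_of_powerMap_eq {α β : simplex} (h : powerMap α = powerMap β) {m : ℕ}
    (hm : ∀ i < m, α.1 i = β.1 i) : α.1 m ≤ β.1 m := by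
  by_contra! hlt
  have key : ∀ j : ℕ, α.1 m ^ (j + 2) ≤ β.1 m ^ (j + 1) := by
    intro j
    have hj := congrFun h j
    simp only [powerMap] at hj
    have sα := subprob.summable_pow α.2.2 (show 0 < j + 2 by omega)
    have sβ := subprob.summable_pow β.2.2 (show 0 < j + 2 by omega)
    rw [← sα.sum_add_tsum_nat_add m, ← sβ.sum_add_tsum_nat_add m,
      Finset.sum_congr rfl fun i hi => by rw [hm i (Finset.mem_range.1 hi)]] at hj
    have hj' := add_left_cancel hj
    have sα' := (summable_nat_add_iff m).2 sα
    have sβ' := (summable_nat_add_iff m).2 sβ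
    have sb := (summable_nat_add_iff m).2 β.2.2.2.1
    calc α.1 m ^ (j + 2) = α.1 (0 + m) ^ (j + 2) := by rw [zero_add]
      _ ≤ ∑' i, α.1 (i + m) ^ (j + 2) := sα'.le_tsum 0 fun i _ => pow_nonneg (α.2.2.1 _) _
      _ = ∑' i, β.1 (i + m) ^ (j + 2) := hj'
      _ ≤ ∑' i, β.1 m ^ (j + 1) * β.1 (i + m) := by
          refine sβ'.tsum_le_tsum (fun i => ?_) (sb.mul_left _)
          rw [pow_succ]
          exact mul_le_mul_of_nonneg_right
            (pow_le_pow_left₀ (β.2.2.1 _) (β.2.1 (Nat.le_add_left m i)) _) (β.2.2.1 _)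
      _ = β.1 m ^ (j + 1) * ∑' i, β.1 (i + m) := tsum_mul_left
      _ ≤ β.1 m ^ (j + 1) * 1 := by
          refine mul_le_mul_of_nonneg_left ?_ (pow_nonneg (β.2.2.1 m) _)
          refine le_trans ?_ β.2.2.2.2
          rw [← β.2.2.2.1.sum_add_tsum_nat_add m]
          exact le_add_of_nonneg_left (Finset.sum_nonneg fun i _ => β.2.2.1 i)
      _ = β.1 m ^ (j + 1) := mul_one _
  have hb := β.2.2.1 m
  have ha : 0 < α.1 m := lt_of_le_of_lt hb hlt
  obtain ⟨j, hj⟩ := exists_pow_lt_of_lt_one ha ((div_lt_one ha).2 hlt)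
  have h1 : (β.1 m / α.1 m) ^ (j + 1) < α.1 m :=
    (pow_le_pow_of_le_one (by positivity) ((div_lt_one ha).2 hlt).le (Nat.le_succ j)).trans_lt hj
  rw [div_pow, div_lt_iff₀ (by positivity)] at h1
  have h2 := key j
  rw [pow_succ'] at h2
  linarith

lemma injective_powerMap : Function.Injective powerMap := by
  intro α β h
  apply Subtype.ext
  funext m
  induction m using Nat.strong_induction_on with
  | _ m ih =>
    exact le_antisymm (le_of_powerMap_eq h ih)
      (le_of_powerMap_eq h.symm fun i hi => (ih i hi).symm)

lemma isClosedEmbedding_powerMap : IsClosedEmbedding powerMap :=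
  continuous_powerMap.isClosedEmbedding injective_powerMap

/-- A finite measure on a compact space is determined by the integrals of polynomials in a family of
continuous functions that separates points. -/
lemma ext_of_integral_eval {E σ : Type*} [TopologicalSpace E] [CompactSpace E] [PolishSpace E]
    [MeasurableSpace E] [BorelSpace E] {P Q : Measure E} [IsFiniteMeasure P] [IsFiniteMeasure Q]
    {p : σ → E → ℝ} (hp : ∀ i, Continuous (p i)) (hsep : ∀ x y, (∀ i, p i x = p i y) → x = y)
    (h : ∀ f : MvPolynomial σ ℝ, ∫ x, MvPolynomial.eval (fun i => p i x) f ∂P =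
      ∫ x, MvPolynomial.eval (fun i => p i x) f ∂Q) : P = Q := by
  let q : σ → BoundedContinuousFunction E ℝ := fun i =>
    BoundedContinuousFunction.mkOfCompact ⟨p i, hp i⟩
  let Φ : MvPolynomial σ ℝ →ₐ[ℝ] BoundedContinuousFunction E ℝ := MvPolynomial.aeval q
  have hΦ : ∀ f x, Φ f x = MvPolynomial.eval (fun i => p i x) f := by
    intro f x
    induction f using MvPolynomial.induction_on with
    | C a => simp [Φ]
    | add f g hf hg => rw [map_add, BoundedContinuousFunction.add_apply, hf, hg, map_add]
    | mul_X f i hf => rw [map_mul, BoundedContinuousFunction.mul_apply, hf]; simp [Φ, q]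
  let A : StarSubalgebra ℝ (BoundedContinuousFunction E ℝ) :=
    { Φ.range with
      star_mem' := by
        intro a ha
        have : star a = a := by ext; simp
        simpa [this] using ha }
  refine ext_of_forall_mem_subalgebra_integral_eq_of_polish (𝕜 := ℝ) (A := A) ?_ ?_
  · intro x y hxy
    obtain ⟨i, hi⟩ : ∃ i, p i x ≠ p i y := by
      by_contra! hall
      exact hxy (hsep x y hall)
    refine ⟨_, ⟨_, ⟨Φ (MvPolynomial.X i), ⟨_, rfl⟩, rfl⟩, rfl⟩, ?_⟩
    simpa [hΦ] using hi
  · rintro _ ⟨f, rfl⟩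
    simpa [hΦ] using h f

/-- A measure on the simplex is determined by the integrals of symmetric functions. -/
lemma ext_of_integral_specialize {P Q : Measure simplex} [IsFiniteMeasure P] [IsFiniteMeasure Q]
    (h : ∀ f, ∫ α, specialize α f ∂P = ∫ α, specialize α f ∂Q) : P = Q := by
  refine ext_of_integral_eval (p := fun k α => extPowerSum α k) continuous_extPowerSum
    (fun α β hαβ => injective_powerMap (funext fun k => ?_)) h
  have hk : (⟨k + 2, by omega⟩ : ℕ+) ≠ 1 := fun h => by
    have : k + 2 = 1 := congrArg PNat.val h
    omega
  have := hαβ ⟨k + 2, by omega⟩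
  rwa [extPowerSum_of_ne hk, extPowerSum_of_ne hk] at this

/-! ### Moment characterization of the Poisson--Dirichlet distribution -/

/-- The partition with parts `k i`. -/
def partitionOf {ι : Type*} [Fintype ι] (k : ι → ℕ) (hk : ∀ i, 0 < k i) :
    (∑ i, k i).Partition where
  parts := Finset.univ.val.map k
  parts_pos := by
    intro i hi
    obtain ⟨j, -, rfl⟩ := Multiset.mem_map.1 hi
    exact hk j
  parts_sum := rfl

lemma prod_count_factorial_ne_zero (s : Multiset ℕ) :
    ((∏ c ∈ s.toFinset, (s.count c).factorial : ℕ) : ℝ) ≠ 0 :=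
  Nat.cast_ne_zero.2 (Finset.prod_ne_zero_iff.2 fun _ _ => Nat.factorial_ne_zero _)

lemma specialize_smul (α : simplex) (c : ℝ) (f : SymFun) :
    specialize α (c • f) = c * specialize α f := by
  simp [specialize]

section Moments

variable {ι : Type*} [Fintype ι] [DecidableEq ι] {t : ℝ} {P : Measure simplex}

lemma IsPoissonDirichlet.integral_augmented (hP : IsPoissonDirichlet t P) {k : ι → ℕ}
    (hk : ∀ i, 0 < k i) {f : SymFun} (hf : IsAugmentedMonomial k f) :
    ∫ α, specialize α f ∂P = augMoment t k := by
  let lam := partitionOf k hk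
  have hlam : Finset.univ.val.map k = lam.parts := rfl
  have hc := prod_count_factorial_ne_zero lam.parts
  set c : ℝ := ((∏ c ∈ lam.parts.toFinset, (lam.parts.count c).factorial : ℕ) : ℝ) with hcdef
  have hm : IsMonomialSymm lam (c⁻¹ • f) := fun N => by
    change toPoly N (c⁻¹ • f) = _
    rw [map_smul, hf N, augSum_X_eq_smul_msymm hlam, ← hcdef, smul_smul, inv_mul_cancel₀ hc,
      one_smul]
  have h := hP.integral_monomial _ lam _ hm
  simp only [specialize_smul, integral_const_mul] at h
  rw [← augMoment_eq hlam, ← h, ← hcdef]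
  field_simp

/-- Integral of a product of power sums. -/
lemma IsPoissonDirichlet.integral_prod_powerSum {ι : Type} [Fintype ι] [DecidableEq ι]
    (hP : IsPoissonDirichlet t P) {k : ι → ℕ} (hk : ∀ i, 0 < k i) :
    ∫ α, specialize α (∏ j, powerSum (k j)) ∂P =
      ∑ π : Finpartition (Finset.univ : Finset ι),
        augMoment t (fun B : {B : Finset ι // B ∈ π.parts} => ∑ j ∈ B.1, k j) := by
  have := hP.isProbabilityMeasure
  have H := fun π : Finpartition (Finset.univ : Finset ι) => exists_isAugmentedMonomial
    (fun B : {B : Finset ι // B ∈ π.parts} => ∑ j ∈ B.1, k j) (blockSum_pos π hk)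
  choose F hF using H
  have hcongr : ∀ N, toPoly N (∏ j, powerSum (k j)) = toPoly N (∑ π, F π) := fun N => by
    simp only [map_prod, toPoly_powerSum (hk _), map_sum, hF _ N]
    rw [prod_sum_pow_eq_sum_augSum]
  simp only [specialize_congr hcongr]
  have hsum : ∀ α, specialize α (∑ π, F π) = ∑ π, specialize α (F π) := fun α => by
    simp [specialize]
  simp only [hsum]
  rw [integral_finsetSum _ fun π _ => integrable_specialize P (F π)]
  exact Finset.sum_congr rfl fun π _ => hP.integral_augmented (blockSum_pos π hk) (hF π)

end Moments

/-! ### Uniqueness of the Poisson–Dirichlet distribution, and a criterion through augmented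
monomials. -/

lemma monomial_eq_prod_powerSum (d : ℕ+ →₀ ℕ) : ∃ (n : ℕ) (k : Fin n → ℕ), (∀ i, 0 < k i) ∧
    MvPolynomial.monomial d (1 : ℝ) = ∏ j, powerSum (k j) := by
  induction d using Finsupp.induction_linear with
  | zero => exact ⟨0, Fin.elim0, fun i => i.elim0, by simp⟩
  | add d e hd he =>
    obtain ⟨n, k, hk, h⟩ := hd
    obtain ⟨m, l, hl, h'⟩ := he
    refine ⟨n + m, Fin.append k l, fun i => ?_, ?_⟩
    · refine Fin.addCases (fun i => ?_) (fun i => ?_) i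
      · simpa using hk i
      · simpa using hl i
    · rw [Fin.prod_univ_add]
      simp only [Fin.append_left, Fin.append_right]
      rw [← h, ← h', MvPolynomial.monomial_mul, mul_one]
  | single a b =>
    refine ⟨b, fun _ => a, fun _ => a.pos, ?_⟩
    rw [Finset.prod_const, Finset.card_univ, Fintype.card_fin, powerSum,
      MvPolynomial.X_pow_eq_monomial]
    simp

lemma IsPoissonDirichlet.unique {t : ℝ} {P Q : Measure simplex} (hP : IsPoissonDirichlet t P)
    (hQ : IsPoissonDirichlet t Q) : P = Q := by
  have := hP.isProbabilityMeasure
  have := hQ.isProbabilityMeasure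
  refine ext_of_integral_specialize fun f => ?_
  induction f using MvPolynomial.induction_on' with
  | monomial d a =>
    obtain ⟨n, k, hk, h⟩ := monomial_eq_prod_powerSum d
    have h' : MvPolynomial.monomial d a = a • ∏ j, powerSum (k j) := by
      rw [← h, MvPolynomial.smul_monomial, smul_eq_mul, mul_one]
    simp only [h', specialize_smul, integral_const_mul]
    rw [hP.integral_prod_powerSum hk, hQ.integral_prod_powerSum hk]
  | add f g hf hg =>
    have hadd : ∀ α, specialize α (f + g) = specialize α f + specialize α g := fun α => by
      simp [specialize]
    simp only [hadd]
    rw [integral_add (integrable_specialize P f) (integrable_specialize P g),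
      integral_add (integrable_specialize Q f) (integrable_specialize Q g), hf, hg]

/-- One representative `f` for each exponent sequence suffices, because its specialization does not
depend on the choice. -/
lemma IsPoissonDirichlet.of_integral_augmented {t : ℝ} {P : Measure simplex}
    [hprob : IsProbabilityMeasure P]
    (h : ∀ (n : ℕ) (k : Fin n → ℕ), (∀ i, 0 < k i) → ∃ f, IsAugmentedMonomial k f ∧
      ∫ α, specialize α f ∂P = augMoment t k) : IsPoissonDirichlet t P := by
  refine ⟨hprob, fun n lam m hm => ?_⟩
  obtain ⟨l, hl⟩ : ∃ l : List ℕ, (l : Multiset ℕ) = lam.parts := Quot.exists_rep lam.parts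
  have hlam : Finset.univ.val.map l.get = lam.parts := by
    rw [← hl]
    simp [Fin.univ_val_map]
  have hk : ∀ i, 0 < l.get i := fun i =>
    lam.parts_pos (hlam ▸ Multiset.mem_map_of_mem l.get (Finset.mem_univ i))
  obtain ⟨f, hf, hfP⟩ := h _ l.get hk
  have hc := prod_count_factorial_ne_zero lam.parts
  set c : ℝ := ((∏ c ∈ lam.parts.toFinset, (lam.parts.count c).factorial : ℕ) : ℝ) with hcdef
  have hcongr : ∀ N, toPoly N f = toPoly N (c • m) := fun N => by
    rw [hf N, augSum_X_eq_smul_msymm hlam, map_smul, ← hcdef]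
    congr 1
    exact (hm N).symm
  simp only [specialize_congr hcongr, specialize_smul, integral_const_mul] at hfP
  rw [← augMoment_eq hlam, ← hcdef, mul_comm] at hfP
  exact mul_right_cancel₀ hc hfP

/-! ### Beta integrals -/

lemma lintegral_Ioo_rpow_mul_rpow {a b : ℝ} (ha : 0 < a) (hb : 0 < b) :
    ∫⁻ x in Set.Ioo (0 : ℝ) 1, ENNReal.ofReal (x ^ (a - 1) * (1 - x) ^ (b - 1)) =
      ENNReal.ofReal (ProbabilityTheory.beta a b) := by
  have h := ProbabilityTheory.lintegral_betaPDF_eq_one ha hb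
  have hpos := ProbabilityTheory.beta_pos ha hb
  rw [ProbabilityTheory.lintegral_betaPDF] at h
  simp only [mul_assoc, ENNReal.ofReal_mul (one_div_nonneg.2 hpos.le)] at h
  rw [lintegral_const_mul' _ _ ENNReal.ofReal_ne_top] at h
  calc _ = ENNReal.ofReal (ProbabilityTheory.beta a b) *
        (ENNReal.ofReal (1 / ProbabilityTheory.beta a b) *
        ∫⁻ x in Set.Ioo (0 : ℝ) 1, ENNReal.ofReal (x ^ (a - 1) * (1 - x) ^ (b - 1))) := by
          rw [← mul_assoc, ← ENNReal.ofReal_mul hpos.le, mul_one_div_cancel hpos.ne',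
            ENNReal.ofReal_one, one_mul]
    _ = _ := by rw [h, mul_one]

lemma ascPochhammer_eval_mul_Gamma {t : ℝ} (ht : 0 < t) (n : ℕ) :
    (ascPochhammer ℝ n).eval t * Real.Gamma t = Real.Gamma (t + n) := by
  induction n with
  | zero => simp
  | succ n ih =>
    rw [ascPochhammer_succ_eval, mul_right_comm, ih, mul_comm]
    push_cast
    rw [← add_assoc, Real.Gamma_add_one (by positivity)]

lemma ascPochhammer_eval_pos {t : ℝ} (ht : 0 < t) (n : ℕ) : 0 < (ascPochhammer ℝ n).eval t :=
  ascPochhammer_pos n t ht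

lemma beta_nat_succ_add {t : ℝ} (ht : 0 < t) (a b : ℕ) :
    ProbabilityTheory.beta (a + 1) (t + b) =
      a.factorial * (ascPochhammer ℝ b).eval t / (ascPochhammer ℝ (a + b + 1)).eval t := by
  rw [ProbabilityTheory.beta, Real.Gamma_nat_eq_factorial, ← ascPochhammer_eval_mul_Gamma ht,
    show (a : ℝ) + 1 + (t + b) = t + ((a + b + 1 : ℕ) : ℝ) by push_cast; ring,
    ← ascPochhammer_eval_mul_Gamma ht]
  have h1 := (Real.Gamma_pos_of_pos ht).ne'
  have h2 := (ascPochhammer_eval_pos ht (a + b + 1)).ne'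
  field_simp

lemma beta_one {t : ℝ} (ht : 0 < t) : ProbabilityTheory.beta 1 t = 1 / t := by
  have := beta_nat_succ_add ht 0 0
  simpa using this

/-- The beta distribution with parameters `1` and `t`, on the unit interval. -/
noncomputable def stickLaw (t : ℝ) : Measure unitInterval :=
  (ProbabilityTheory.betaMeasure 1 t).map (Set.projIcc 0 1 zero_le_one)

lemma isProbabilityMeasure_stickLaw {t : ℝ} (ht : 0 < t) :
    IsProbabilityMeasure (stickLaw t) := by
  have := ProbabilityTheory.isProbabilityMeasureBeta (α := 1) (β := t) one_pos ht
  exact Measure.isProbabilityMeasure_map continuous_projIcc.aemeasurable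

/-- The density is `t (1 - x) ^ (t - 1)`, so the integral is `t` times the beta function at `(a + 1,
t + b)`. -/
lemma integral_stickLaw {t : ℝ} (ht : 0 < t) (a b : ℕ) :
    ∫ w, (w : ℝ) ^ a * (1 - (w : ℝ)) ^ b ∂(stickLaw t) =
      t * (a.factorial * (ascPochhammer ℝ b).eval t / (ascPochhammer ℝ (a + b + 1)).eval t) := by
  have hcont : Continuous fun w : unitInterval => (w : ℝ) ^ a * (1 - (w : ℝ)) ^ b := by fun_prop
  have hmeas : Measurable fun x : ℝ => ENNReal.ofReal
      ((Set.projIcc 0 1 zero_le_one x : ℝ) ^ a * (1 - (Set.projIcc 0 1 zero_le_one x : ℝ)) ^ b) :=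
    (hcont.comp continuous_projIcc).measurable.ennreal_ofReal
  have hpb := ProbabilityTheory.beta_pos (show (0 : ℝ) < a + 1 by positivity)
    (show 0 < t + b by positivity)
  rw [integral_eq_lintegral_of_nonneg_ae
    (ae_of_all _ fun w => mul_nonneg (pow_nonneg w.2.1 _) (pow_nonneg (sub_nonneg.2 w.2.2) _))
    hcont.aestronglyMeasurable, ← beta_nat_succ_add ht]
  rw [← ENNReal.toReal_ofReal (mul_nonneg ht.le hpb.le)]
  congr 1
  rw [stickLaw, lintegral_map (by fun_prop) continuous_projIcc.measurable,
    ProbabilityTheory.betaMeasure, lintegral_withDensity_eq_lintegral_mul₀ (by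
      unfold ProbabilityTheory.betaPDF; fun_prop)
      hmeas.aemeasurable,
    ENNReal.ofReal_mul ht.le, ← lintegral_Ioo_rpow_mul_rpow (by positivity) (by positivity),
    ← lintegral_const_mul' _ _ ENNReal.ofReal_ne_top, ← lintegral_indicator measurableSet_Ioo]
  refine lintegral_congr fun x => ?_
  simp only [Pi.mul_apply, Set.indicator]
  split_ifs with hx
  · rw [ProbabilityTheory.betaPDF_of_pos_lt_one hx.1 hx.2, Set.projIcc_of_mem _ ⟨hx.1.le, hx.2.le⟩,
      beta_one ht, one_div_one_div, ← ENNReal.ofReal_mul ht.le, ← ENNReal.ofReal_mul (by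
        have h1 : 0 < 1 - x := sub_pos.2 hx.2
        have h2 := hx.1
        positivity)]
    congr 1
    have h1 : 0 < 1 - x := sub_pos.2 hx.2
    rw [sub_self, Real.rpow_zero, add_sub_cancel_right, Real.rpow_natCast,
      show t + b - 1 = (t - 1) + b by ring, Real.rpow_add h1, Real.rpow_natCast]
    ring
  · have : ProbabilityTheory.betaPDF 1 t x = 0 := by
      rw [ProbabilityTheory.betaPDF_eq, if_neg (show ¬(0 < x ∧ x < 1) from hx), ENNReal.ofReal_zero]
    rw [this, zero_mul]

/-! ### Splitting off one variable -/

section SplitOff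

variable {R : Type*} [CommSemiring R]

/-- An injection into `Fin (N + 1)` either avoids `0` or takes the value `0` exactly once. -/
def extendEmbedding {n N : ℕ} :
    (Fin (n + 1) ↪ Fin N) ⊕ (Fin (n + 1) × (Fin n ↪ Fin N)) → (Fin (n + 1) ↪ Fin (N + 1))
  | .inl g => g.trans (Fin.succEmb N)
  | .inr (j, g) => ⟨Fin.insertNth j 0 (fun i => (g i).succ), by
      intro a b hab
      rcases Fin.eq_self_or_eq_succAbove j a with h' | ⟨a, rfl⟩ <;>
        rcases Fin.eq_self_or_eq_succAbove j b with h | ⟨b, rfl⟩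
      · exact h'.trans h.symm
      · rw [h', Fin.insertNth_apply_same, Fin.insertNth_apply_succAbove] at hab
        exact absurd hab.symm (Fin.succ_ne_zero _)
      · rw [h, Fin.insertNth_apply_same, Fin.insertNth_apply_succAbove] at hab
        exact absurd hab (Fin.succ_ne_zero _)
      · rw [Fin.insertNth_apply_succAbove, Fin.insertNth_apply_succAbove] at hab
        rw [g.injective (Fin.succ_injective _ hab)]⟩

lemma extendEmbedding_inr_self {n N : ℕ} (j : Fin (n + 1)) (g : Fin n ↪ Fin N) :
    extendEmbedding (.inr (j, g)) j = 0 := by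
  change Fin.insertNth (α := fun _ => Fin (N + 1)) j 0 (fun i => (g i).succ) j = 0
  rw [Fin.insertNth_apply_same]

lemma extendEmbedding_inr_succAbove {n N : ℕ} (j : Fin (n + 1)) (g : Fin n ↪ Fin N) (i : Fin n) :
    extendEmbedding (.inr (j, g)) (j.succAbove i) = (g i).succ := by
  change Fin.insertNth (α := fun _ => Fin (N + 1)) j 0 (fun i => (g i).succ) (j.succAbove i) = _
  rw [Fin.insertNth_apply_succAbove]

lemma extendEmbedding_inl {n N : ℕ} (g : Fin (n + 1) ↪ Fin N) (i : Fin (n + 1)) :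
    extendEmbedding (.inl g) i = (g i).succ := rfl

lemma bijective_extendEmbedding {n N : ℕ} :
    Function.Bijective (extendEmbedding (n := n) (N := N)) := by
  constructor
  · rintro (g | ⟨j, g⟩) (h | ⟨l, h⟩) hgh
    · congr 1
      ext1 i
      exact Fin.succ_injective _ (DFunLike.congr_fun hgh i)
    · have := DFunLike.congr_fun hgh l
      rw [extendEmbedding_inr_self, extendEmbedding_inl] at this
      exact absurd this (Fin.succ_ne_zero _)
    · have := DFunLike.congr_fun hgh j
      rw [extendEmbedding_inr_self, extendEmbedding_inl] at this
      exact absurd this.symm (Fin.succ_ne_zero _)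
    · have hj := DFunLike.congr_fun hgh j
      rw [extendEmbedding_inr_self, ← extendEmbedding_inr_self l h] at hj
      have hjl := (extendEmbedding (.inr (l, h))).injective hj
      subst hjl
      congr 2
      ext1 i
      have := DFunLike.congr_fun hgh (Fin.succAbove l i)
      rw [extendEmbedding_inr_succAbove, extendEmbedding_inr_succAbove] at this
      exact Fin.succ_injective _ this
  · intro g
    by_cases h : ∃ j, g j = 0
    · obtain ⟨j, hj⟩ := h
      have hne : ∀ i, g (j.succAbove i) ≠ 0 := fun i h0 =>
        Fin.succAbove_ne j i (g.injective (h0.trans hj.symm))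
      refine ⟨.inr (j, ⟨fun i => (g (j.succAbove i)).pred (hne i), fun a b hab => ?_⟩), ?_⟩
      · exact Fin.succAbove_right_injective (g.injective (Fin.pred_inj.1 hab))
      · ext1 i
        rcases Fin.eq_self_or_eq_succAbove j i with rfl | ⟨i, rfl⟩
        · rw [extendEmbedding_inr_self, hj]
        · rw [extendEmbedding_inr_succAbove]
          exact Fin.succ_pred _ (hne i)
    · push Not at h
      refine ⟨.inl ⟨fun i => (g i).pred (h i), fun a b hab => g.injective (Fin.pred_inj.1 hab)⟩, ?_⟩
      ext1 i
      rw [extendEmbedding_inl]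
      exact Fin.succ_pred _ (h i)

lemma augSum_succ {n N : ℕ} (k : Fin (n + 1) → ℕ) (x : Fin (N + 1) → R) :
    augSum k x = augSum k (fun i : Fin N => x i.succ) +
      ∑ j, x 0 ^ k j * augSum (k ∘ j.succAbove) (fun i : Fin N => x i.succ) := by
  unfold augSum
  rw [← bijective_extendEmbedding.sum_comp, Fintype.sum_sum_type, Fintype.sum_prod_type]
  congr 1
  refine Finset.sum_congr rfl fun j _ => ?_
  rw [Finset.mul_sum]
  refine Finset.sum_congr rfl fun g _ => ?_
  rw [Fin.prod_univ_succAbove _ j, extendEmbedding_inr_self]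
  simp only [extendEmbedding_inr_succAbove, Function.comp_apply]

lemma augSum_mul {ι X : Type*} [Fintype ι] [DecidableEq ι] [Fintype X] [DecidableEq X]
    (k : ι → ℕ) (c : R) (x : X → R) :
    augSum k (fun i => c * x i) = c ^ (∑ i, k i) * augSum k x := by
  unfold augSum
  rw [Finset.mul_sum]
  refine Finset.sum_congr rfl fun g _ => ?_
  rw [← Finset.prod_pow_eq_pow_sum, ← Finset.prod_mul_distrib]
  simp only [mul_pow]

end SplitOff

/-! ### Rearranging a sequence in decreasing order -/

/-- The first `N` terms of `v` in decreasing order, followed by zeros. -/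
noncomputable def sortedPrefix (v : ℕ → ℝ) (N : ℕ) (i : ℕ) : ℝ :=
  if h : i < N then v (Tuple.sort (fun j : Fin N => -v j) ⟨i, h⟩) else 0

lemma hasSum_sortedPrefix_pow (v : ℕ → ℝ) (N : ℕ) {k : ℕ} (hk : 0 < k) :
    HasSum (fun i => sortedPrefix v N i ^ k) (∑ i ∈ Finset.range N, v i ^ k) := by
  have h : ∑ i ∈ Finset.range N, v i ^ k = ∑ i ∈ Finset.range N, sortedPrefix v N i ^ k := by
    rw [← Fin.sum_univ_eq_sum_range (fun i => v i ^ k),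
      ← Fin.sum_univ_eq_sum_range (fun i => sortedPrefix v N i ^ k),
      ← Equiv.sum_comp (Tuple.sort (fun j : Fin N => -v j))]
    exact Finset.sum_congr rfl fun i _ => by simp [sortedPrefix]
  rw [h]
  refine hasSum_sum_of_ne_finset_zero fun i hi => ?_
  rw [sortedPrefix, dif_neg (fun h => hi (Finset.mem_range.2 h)), zero_pow hk.ne']

lemma sortedPrefix_mem_simplex {v : ℕ → ℝ} (hv : v ∈ subprob) (N : ℕ) :
    sortedPrefix v N ∈ simplex := by
  have hnn : ∀ i, 0 ≤ sortedPrefix v N i := fun i => by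
    rw [sortedPrefix]; split_ifs
    · exact hv.1 _
    · exact le_rfl
  have hs := hasSum_sortedPrefix_pow v N one_pos
  simp only [pow_one] at hs
  refine ⟨fun i j hij => ?_, hnn, hs.summable, ?_⟩
  · by_cases hj : j < N
    · have hi : i < N := hij.trans_lt hj
      have := Tuple.monotone_sort (fun j : Fin N => -v j)
        (show (⟨i, hi⟩ : Fin N) ≤ ⟨j, hj⟩ from hij)
      simp only [Function.comp_apply, neg_le_neg_iff] at this
      simpa [sortedPrefix, hi, hj] using this
    · have : sortedPrefix v N j = 0 := by simp [sortedPrefix, hj]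
      rw [this]
      exact hnn i
  · rw [hs.tsum_eq]
    exact (hv.2.1.sum_le_tsum _ fun i _ => hv.1 i).trans hv.2.2

/-- This replaces the construction of an infinite decreasing rearrangement: the range of `powerMap`
is closed and contains the power sums of all sorted prefixes. -/
lemma exists_powerMap_eq {v : ℕ → ℝ} (hv : v ∈ subprob) :
    ∃ α : simplex, powerMap α = fun k => ∑' i, v i ^ (k + 2) := by
  change (fun k => ∑' i, v i ^ (k + 2)) ∈ Set.range powerMap
  refine isClosedEmbedding_powerMap.isClosed_range.mem_of_tendsto
    (b := atTop) (f := fun N => powerMap ⟨_, sortedPrefix_mem_simplex hv N⟩) ?_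
    (Eventually.of_forall fun N => ⟨_, rfl⟩)
  refine tendsto_pi_nhds.2 fun k => ?_
  have hk : 0 < k + 2 := by omega
  simp only [powerMap, (hasSum_sortedPrefix_pow v _ hk).tsum_eq]
  exact (subprob.summable_pow hv hk).hasSum.tendsto_sum_nat

/-! ### Stick breaking -/

/-- Prepend a term to a sequence. -/
def consSeq (p : unitInterval × (ℕ → unitInterval)) : ℕ → unitInterval
  | 0 => p.1
  | n + 1 => p.2 n

lemma measurable_consSeq : Measurable consSeq := by
  refine measurable_pi_lambda _ fun n => ?_
  cases n with
  | zero => exact measurable_fst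
  | succ n => exact (measurable_pi_apply n).comp measurable_snd

lemma measurePreserving_consSeq (β : Measure unitInterval) [IsProbabilityMeasure β] :
    MeasurePreserving consSeq (β.prod (Measure.infinitePi fun _ : ℕ => β))
      (Measure.infinitePi fun _ : ℕ => β) := by
  refine ⟨measurable_consSeq, Measure.eq_infinitePi _ fun s A hA => ?_⟩
  classical
  rw [Measure.map_apply measurable_consSeq
    (MeasurableSet.pi s.countable_toSet fun i _ => hA i)]
  let s' : Finset ℕ := s.preimage Nat.succ Nat.succ_injective.injOn
  have hpre : consSeq ⁻¹' ((s : Set ℕ).pi A) =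
      (if 0 ∈ s then A 0 else Set.univ) ×ˢ ((s' : Set ℕ).pi fun i => A (i + 1)) := by
    ext ⟨w, ω⟩
    simp only [Set.mem_preimage, Set.mem_pi, Set.mem_prod, s', Finset.mem_coe, Finset.mem_preimage]
    constructor
    · intro h
      refine ⟨?_, fun i hi => h _ hi⟩
      split_ifs with h0
      · exact h 0 h0
      · trivial
    · rintro ⟨h0, h1⟩ i hi
      cases i with
      | zero => rw [if_pos hi] at h0; exact h0
      | succ i => exact h1 i hi
  rw [hpre, Measure.prod_prod, Measure.infinitePi_pi _ fun i _ => hA (i + 1)]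
  have himg : s.erase 0 = s'.image Nat.succ := by
    ext i
    simp only [s', Finset.mem_erase, Finset.mem_image, Finset.mem_preimage]
    constructor
    · rintro ⟨h0, hi⟩
      obtain ⟨j, rfl⟩ := Nat.exists_eq_succ_of_ne_zero h0
      exact ⟨j, hi, rfl⟩
    · rintro ⟨j, hj, rfl⟩
      exact ⟨Nat.succ_ne_zero j, hj⟩
  have hprod : ∏ i ∈ s', β (A (i + 1)) = ∏ i ∈ s.erase 0, β (A i) := by
    rw [himg, Finset.prod_image fun _ _ _ _ h => Nat.succ_injective h]
  rw [hprod]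
  split_ifs with h0
  · rw [Finset.mul_prod_erase s (fun i => β (A i)) h0]
  · rw [measure_univ, one_mul, Finset.erase_eq_of_notMem h0]

/-- Break off the fraction `w` of the unit stick, and the rest according to `v`. -/
def breakOff (w : ℝ) (v : ℕ → ℝ) : ℕ → ℝ
  | 0 => w
  | n + 1 => (1 - w) * v n

/-- The lengths of the pieces of the unit stick, if the fraction `ω n` of the remaining stick is
broken off at the `n`-th step. -/
def sticks : ℕ → (ℕ → unitInterval) → ℝ
  | 0, ω => ω 0
  | n + 1, ω => (1 - ω 0) * sticks n fun i => ω (i + 1)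

lemma sticks_consSeq (w : unitInterval) (ω : ℕ → unitInterval) :
    (fun n => sticks n (consSeq (w, ω))) = breakOff w fun n => sticks n ω := by
  funext n
  cases n <;> rfl

lemma measurable_sticks (n : ℕ) : Measurable (sticks n) := by
  induction n with
  | zero => exact measurable_subtype_coe.comp (measurable_pi_apply 0)
  | succ n ih =>
    have h0 : Measurable fun ω : ℕ → unitInterval => (ω 0 : ℝ) :=
      measurable_subtype_coe.comp (measurable_pi_apply 0)
    exact (measurable_const.sub h0).mul
      (ih.comp (measurable_pi_lambda _ fun i => measurable_pi_apply (i + 1)))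

lemma sticks_nonneg (n : ℕ) : ∀ ω, 0 ≤ sticks n ω := by
  induction n with
  | zero => exact fun ω => (ω 0).2.1
  | succ n ih => exact fun ω => mul_nonneg (sub_nonneg.2 (ω 0).2.2) (ih _)

lemma sum_sticks_le (N : ℕ) : ∀ ω, ∑ i ∈ Finset.range N, sticks i ω ≤ 1 := by
  induction N with
  | zero => intro ω; simp
  | succ N ih =>
    intro ω
    rw [Finset.sum_range_succ']
    simp only [sticks]
    rw [← Finset.mul_sum]
    have h1 := mul_le_mul_of_nonneg_left (ih fun i => ω (i + 1)) (sub_nonneg.2 (ω 0).2.2)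
    linarith

lemma sticks_mem_subprob (ω : ℕ → unitInterval) : (fun n => sticks n ω) ∈ subprob := by
  have hs : Summable fun n => sticks n ω :=
    summable_of_sum_range_le (fun n => sticks_nonneg n ω) fun N => sum_sticks_le N ω
  exact ⟨fun n => sticks_nonneg n ω, hs, hs.tsum_le_of_sum_range_le fun N => sum_sticks_le N ω⟩

lemma breakOff_mem_subprob {w : ℝ} (hw : w ∈ Set.Icc (0 : ℝ) 1) {v : ℕ → ℝ} (hv : v ∈ subprob) :
    breakOff w v ∈ subprob := by
  have h1 : 0 ≤ 1 - w := sub_nonneg.2 hw.2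
  have hs : HasSum (breakOff w v) ((1 - w) * ∑' i, v i + w) := by
    rw [← hasSum_nat_add_iff' 1]
    simpa [breakOff] using hv.2.1.hasSum.mul_left (1 - w)
  refine ⟨fun n => ?_, hs.summable, ?_⟩
  · cases n with
    | zero => exact hw.1
    | succ n => exact mul_nonneg h1 (hv.1 n)
  · rw [hs.tsum_eq]
    have := mul_le_mul_of_nonneg_left hv.2.2 h1
    linarith

/-- In an injection either no exponent or exactly one exponent `k j` falls on the first piece. The
factor `w ^ 0` lets one beta integral serve both kinds of terms. -/
lemma seqEval_breakOff {n : ℕ} {k : Fin (n + 1) → ℕ} {f : SymFun} {F : Fin (n + 1) → SymFun}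
    (hf : IsAugmentedMonomial k f) (hF : ∀ j, IsAugmentedMonomial (k ∘ j.succAbove) (F j))
    {w : ℝ} (hw : w ∈ Set.Icc (0 : ℝ) 1) {v : ℕ → ℝ} (hv : v ∈ subprob) :
    seqEval (breakOff w v) f = w ^ 0 * (1 - w) ^ (∑ i, k i) * seqEval v f +
      ∑ j, w ^ k j * (1 - w) ^ (∑ i, k (j.succAbove i)) * seqEval v (F j) := by
  refine tendsto_nhds_unique
    ((tendsto_augSum hf (breakOff_mem_subprob hw hv)).comp (tendsto_add_atTop_nat 1)) ?_
  refine Tendsto.congr (f₁ := fun N => w ^ 0 * (1 - w) ^ (∑ i, k i) *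
      augSum k (fun i : Fin N => v i) + ∑ j, w ^ k j * (1 - w) ^ (∑ i, k (j.succAbove i)) *
      augSum (k ∘ j.succAbove) (fun i : Fin N => v i)) (fun N => ?_) ?_
  · simp only [Function.comp_apply]
    rw [augSum_succ]
    simp only [Fin.val_succ, Fin.val_zero, breakOff, augSum_mul, pow_zero, one_mul, mul_assoc,
      Function.comp_apply]
  · exact ((tendsto_augSum hf hv).const_mul _).add
      (tendsto_finsetSum _ fun j _ => (tendsto_augSum (hF j) hv).const_mul _)

lemma measurable_tsum_sticks_pow {k : ℕ} (hk : 0 < k) :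
    Measurable fun ω => ∑' i, sticks i ω ^ k :=
  measurable_of_tendsto_metrizable
    (f := fun N ω => ∑ i ∈ Finset.range N, sticks i ω ^ k)
    (fun _ => Finset.measurable_sum _ fun i _ => (measurable_sticks i).pow_const k)
    (tendsto_pi_nhds.2 fun ω =>
      (subprob.summable_pow (sticks_mem_subprob ω) hk).hasSum.tendsto_sum_nat)

lemma measurable_seqEval_sticks (f : SymFun) :
    Measurable fun ω => seqEval (fun n => sticks n ω) f :=
  (MvPolynomial.continuous_eval f).measurable.comp
    (measurable_pi_lambda _ fun k => measurable_tsum_sticks_pow k.pos)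

lemma exists_bound_seqEval (f : SymFun) : ∃ C, ∀ v ∈ subprob, ‖seqEval v f‖ ≤ C := by
  obtain ⟨C, hC⟩ := (isCompact_univ_pi fun _ : ℕ+ => isCompact_Icc (a := (0 : ℝ))
    (b := 1)).exists_bound_of_continuousOn (MvPolynomial.continuous_eval f).continuousOn
  exact ⟨C, fun v hv => hC _ fun k _ =>
    ⟨subprob.tsum_pow_nonneg hv _, subprob.tsum_pow_le hv k.pos⟩⟩

lemma integrable_seqEval_sticks (ρ : Measure (ℕ → unitInterval)) [IsFiniteMeasure ρ]
    (f : SymFun) : Integrable (fun ω => seqEval (fun n => sticks n ω) f) ρ := by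
  obtain ⟨C, hC⟩ := exists_bound_seqEval f
  exact Integrable.of_bound (measurable_seqEval_sticks f).aestronglyMeasurable C
    (ae_of_all _ fun ω => hC _ (sticks_mem_subprob ω))

section StickBreaking

variable {t : ℝ} [IsProbabilityMeasure (stickLaw t)]

lemma integral_seqEval_sticks_succ (ht : 0 < t) {n : ℕ} {k : Fin (n + 1) → ℕ} {f : SymFun}
    {F : Fin (n + 1) → SymFun} (hf : IsAugmentedMonomial k f)
    (hF : ∀ j, IsAugmentedMonomial (k ∘ j.succAbove) (F j)) :
    ∫ ω, seqEval (fun n => sticks n ω) f ∂(Measure.infinitePi fun _ => stickLaw t) =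
      t * ((ascPochhammer ℝ (∑ i, k i)).eval t / (ascPochhammer ℝ (∑ i, k i + 1)).eval t) *
        ∫ ω, seqEval (fun n => sticks n ω) f ∂(Measure.infinitePi fun _ => stickLaw t) +
      ∑ j, t * ((k j).factorial * (ascPochhammer ℝ (∑ i, k (j.succAbove i))).eval t /
          (ascPochhammer ℝ (∑ i, k i + 1)).eval t) *
        ∫ ω, seqEval (fun n => sticks n ω) (F j) ∂(Measure.infinitePi fun _ => stickLaw t) := by
  set ρ := Measure.infinitePi fun _ : ℕ => stickLaw t with hρ
  have hpow : ∀ a b : ℕ, Integrable (fun w : unitInterval => (w : ℝ) ^ a * (1 - (w : ℝ)) ^ b)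
      (stickLaw t) := fun a b => by
    have hc : Continuous fun w : unitInterval => (w : ℝ) ^ a * (1 - (w : ℝ)) ^ b := by fun_prop
    rw [← integrableOn_univ]
    exact hc.continuousOn.integrableOn_compact isCompact_univ
  have hint : ∀ (a b : ℕ) (g : SymFun), Integrable
      (fun p : unitInterval × (ℕ → unitInterval) => (p.1 : ℝ) ^ a * (1 - (p.1 : ℝ)) ^ b *
        seqEval (fun n => sticks n p.2) g) ((stickLaw t).prod ρ) := fun a b g =>
    (hpow a b).mul_prod (integrable_seqEval_sticks ρ g)
  have hval : ∀ (a b : ℕ) (g : SymFun),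
      ∫ p : unitInterval × (ℕ → unitInterval), (p.1 : ℝ) ^ a * (1 - (p.1 : ℝ)) ^ b *
        seqEval (fun n => sticks n p.2) g ∂((stickLaw t).prod ρ) =
      t * (a.factorial * (ascPochhammer ℝ b).eval t / (ascPochhammer ℝ (a + b + 1)).eval t) *
        ∫ ω, seqEval (fun n => sticks n ω) g ∂ρ := fun a b g => by
    rw [← integral_stickLaw ht]
    exact integral_prod_mul (fun w : unitInterval => (w : ℝ) ^ a * (1 - (w : ℝ)) ^ b)
      (fun ω => seqEval (fun n => sticks n ω) g)
  have hcons : ∀ p : unitInterval × (ℕ → unitInterval),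
      seqEval (fun n => sticks n (consSeq p)) f =
        (p.1 : ℝ) ^ 0 * (1 - (p.1 : ℝ)) ^ (∑ i, k i) * seqEval (fun n => sticks n p.2) f +
        ∑ j, (p.1 : ℝ) ^ k j * (1 - (p.1 : ℝ)) ^ (∑ i, k (j.succAbove i)) *
          seqEval (fun n => sticks n p.2) (F j) := fun p => by
    rw [← seqEval_breakOff hf hF p.1.2 (sticks_mem_subprob p.2), ← sticks_consSeq]
  have hmp := measurePreserving_consSeq (stickLaw t)
  rw [← hρ] at hmp
  -- The same integral occurs on the right and must stay untouched there.
  conv_lhs =>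
    rw [← hmp.map_eq, integral_map hmp.measurable.aemeasurable
      (measurable_seqEval_sticks f).aestronglyMeasurable]
  simp only [hcons]
  rw [integral_add (hint _ _ _) (integrable_finsetSum _ fun j _ => hint _ _ _),
    integral_finsetSum _ fun j _ => hint _ _ _]
  simp only [hval]
  congr 1
  · simp
  · refine Finset.sum_congr rfl fun j _ => ?_
    rw [← Fin.sum_univ_succAbove k j]

/-- With `K = ∑ k i`, the unknown appears on the right with coefficient `t / (t + K)`, and by
induction the `j`-th remaining term is a common factor times `k j`. The equation becomes `K` times
the claim, up to a nonzero factor, and `K > 0`. -/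
lemma integral_seqEval_sticks (ht : 0 < t) {n : ℕ} : ∀ {k : Fin n → ℕ}, (∀ i, 0 < k i) →
    ∀ {f : SymFun}, IsAugmentedMonomial k f →
    ∫ ω, seqEval (fun n => sticks n ω) f ∂(Measure.infinitePi fun _ => stickLaw t) =
      augMoment t k := by
  induction n with
  | zero =>
    intro k _ f hf
    have : ∀ ω, seqEval (fun n => sticks n ω) f = 1 := fun ω => by
      refine tendsto_nhds_unique (tendsto_augSum hf (sticks_mem_subprob ω)) ?_
      simp [augSum]
    simp [this, augMoment]
  | succ n ih =>
    intro k hk f hf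
    choose F hF using fun j : Fin (n + 1) =>
      exists_isAugmentedMonomial (k ∘ j.succAbove) fun i => hk _
    have h := integral_seqEval_sticks_succ ht hf hF
    have hind := fun j => ih (fun i => hk (Fin.succAbove j i)) (hF j)
    simp only [hind] at h
    set I := ∫ ω, seqEval (fun n => sticks n ω) f ∂(Measure.infinitePi fun _ => stickLaw t)
    set K := ∑ i, k i with hK
    have hterm : ∀ j, t * ((k j).factorial * (ascPochhammer ℝ (∑ i, k (j.succAbove i))).eval t /
          (ascPochhammer ℝ (K + 1)).eval t) * augMoment t (fun i => k (j.succAbove i)) =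
        t ^ (n + 1) * (∏ i, ((k i - 1).factorial : ℝ)) / (ascPochhammer ℝ (K + 1)).eval t *
          k j := fun j => by
      rw [augMoment, Fin.prod_univ_succAbove _ j, ← Nat.mul_factorial_pred (hk j).ne']
      have h1 := (ascPochhammer_eval_pos ht (∑ i, k (j.succAbove i))).ne'
      have h2 := (ascPochhammer_eval_pos ht (K + 1)).ne'
      rw [Fintype.card_fin]
      push_cast
      field_simp
      ring
    rw [Finset.sum_congr rfl fun j _ => hterm j, ← Finset.mul_sum, ← Nat.cast_sum, ← hK] at h
    have hKpos : (0 : ℝ) < K := by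
      rw [Nat.cast_pos, hK]
      exact Finset.sum_pos (fun i _ => hk i) ⟨0, Finset.mem_univ _⟩
    rw [augMoment, ← hK, Fintype.card_fin]
    have h1 := (ascPochhammer_eval_pos ht K).ne'
    have h2 : t + K ≠ 0 := by positivity
    rw [ascPochhammer_succ_eval] at h
    field_simp at h ⊢
    have h3 : (K : ℝ) * (I * (ascPochhammer ℝ K).eval t) =
        K * (t ^ (n + 1) * ∏ i, ((k i - 1).factorial : ℝ)) := by linarith
    exact mul_left_cancel₀ hKpos.ne' h3

/-- The total length is at most one and has mean `augMoment t 1 = 1`. -/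
lemma ae_tsum_sticks_eq_one (ht : 0 < t) :
    ∀ᵐ ω ∂(Measure.infinitePi fun _ => stickLaw t), ∑' i, sticks i ω = 1 := by
  have haug : IsAugmentedMonomial (fun _ : Fin 1 => 1) (powerSum 1) := fun N => by
    rw [toPoly_powerSum one_pos, augSum]
    refine Fintype.sum_equiv (Equiv.ofBijective
      (fun i => (⟨fun _ => i, fun _ _ _ => Subsingleton.elim _ _⟩ : Fin 1 ↪ Fin N))
      ⟨fun i j hij => DFunLike.congr_fun hij 0, fun g => ⟨g 0, ?_⟩⟩) _ _ fun i => ?_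
    · ext1 i
      rw [Subsingleton.elim i 0]
      rfl
    · simp
      rfl
  have hmean := integral_seqEval_sticks ht (fun _ => one_pos) haug
  have hval : ∀ ω, seqEval (fun n => sticks n ω) (powerSum 1) = ∑' i, sticks i ω := fun ω => by
    simp [seqEval, powerSum]
  have hint := integrable_seqEval_sticks (Measure.infinitePi fun _ => stickLaw t) (powerSum 1)
  simp only [hval] at hmean hint
  have hone : augMoment t (fun _ : Fin 1 => 1) = 1 := by
    simp [augMoment, ht.ne']
  have hnn : 0 ≤ᵐ[Measure.infinitePi fun _ => stickLaw t] fun ω => 1 - ∑' i, sticks i ω :=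
    ae_of_all _ fun ω => sub_nonneg.2 (sticks_mem_subprob ω).2.2
  have hz : ∫ ω, (1 - ∑' i, sticks i ω) ∂(Measure.infinitePi fun _ => stickLaw t) = 0 := by
    rw [integral_sub (integrable_const _) hint, hmean, hone]
    simp
  filter_upwards [(integral_eq_zero_iff_of_nonneg_ae hnn ((integrable_const _).sub hint)).1 hz]
    with ω hω
  exact (sub_eq_zero.1 hω).symm

end StickBreaking

/-- The decreasing rearrangement of the stick-breaking lengths. -/
noncomputable def sortedSticks (ω : ℕ → unitInterval) : simplex :=
  (exists_powerMap_eq (sticks_mem_subprob ω)).choose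

lemma powerMap_sortedSticks (ω : ℕ → unitInterval) (k : ℕ) :
    powerMap (sortedSticks ω) k = ∑' i, sticks i ω ^ (k + 2) :=
  congrFun (exists_powerMap_eq (sticks_mem_subprob ω)).choose_spec k

/-- Measurability can be tested after the measurable embedding `powerMap`, where the composite is
explicit. -/
lemma measurable_sortedSticks : Measurable sortedSticks := by
  refine (isClosedEmbedding_powerMap.measurableEmbedding.measurable_comp_iff).1
    (measurable_pi_lambda _ fun k => ?_)
  simp only [Function.comp_apply, powerMap_sortedSticks]
  exact measurable_tsum_sticks_pow (by omega)

lemma specialize_sortedSticks {ω : ℕ → unitInterval} (hω : ∑' i, sticks i ω = 1) (f : SymFun) :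
    specialize (sortedSticks ω) f = seqEval (fun n => sticks n ω) f := by
  rw [specialize_eq_eval, seqEval]
  congr 2
  funext k
  by_cases hk : k = 1
  · subst hk
    rw [extPowerSum_one]
    simp [hω]
  · rw [extPowerSum_of_ne hk]
    have h1 := k.pos
    have h2 : (k : ℕ) ≠ 1 := fun h => hk (PNat.eq h)
    obtain ⟨m, hm⟩ : ∃ m, (k : ℕ) = m + 2 := ⟨k - 2, by omega⟩
    rw [hm]
    exact powerMap_sortedSticks ω m

lemma exists_isPoissonDirichlet {t : ℝ} (ht : 0 < t) : ∃ P, IsPoissonDirichlet t P := by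
  have := isProbabilityMeasure_stickLaw ht
  let ρ := Measure.infinitePi fun _ : ℕ => stickLaw t
  have hprob : IsProbabilityMeasure (ρ.map sortedSticks) :=
    Measure.isProbabilityMeasure_map measurable_sortedSticks.aemeasurable
  refine ⟨ρ.map sortedSticks, IsPoissonDirichlet.of_integral_augmented fun n k hk => ?_⟩
  obtain ⟨f, hf⟩ := exists_isAugmentedMonomial k hk
  refine ⟨f, hf, ?_⟩
  rw [integral_map measurable_sortedSticks.aemeasurable
    (continuous_specialize f).aestronglyMeasurable, ← integral_seqEval_sticks ht hk hf]
  refine integral_congr_ae ?_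
  filter_upwards [ae_tsum_sticks_eq_one ht] with ω hω
  exact specialize_sortedSticks hω f

/-! ### Moments determine measures on the cube -/

lemma ext_of_lintegral_prod_pow {n : ℕ} {μ ν : Measure (Fin n → ℝ)} [IsFiniteMeasure μ]
    (hμ : ∀ᵐ x ∂μ, ∀ j, x j ∈ Set.Icc (0 : ℝ) 1) (hν : ∀ᵐ x ∂ν, ∀ j, x j ∈ Set.Icc (0 : ℝ) 1)
    (h : ∀ a : Fin n → ℕ, ∫⁻ x, ∏ j, ENNReal.ofReal (x j) ^ a j ∂μ =
      ∫⁻ x, ∏ j, ENNReal.ofReal (x j) ^ a j ∂ν) : μ = ν := by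
  -- The zeroth moment is the total mass, so `ν` is finite too.
  have hmass := h 0
  simp only [Pi.zero_apply, pow_zero, Finset.prod_const_one, lintegral_const, one_mul] at hmass
  have hfin : IsFiniteMeasure ν := ⟨by rw [← hmass]; exact measure_lt_top μ _⟩
  let c : (Fin n → ℝ) → (Fin n → unitInterval) := fun x j => Set.projIcc 0 1 zero_le_one (x j)
  have hc : Continuous c := continuous_pi fun j => continuous_projIcc.comp (continuous_apply j)
  let d : (Fin n → unitInterval) → (Fin n → ℝ) := fun y j => y j
  have hd : Continuous d := by fun_prop
  have hback : ∀ {κ : Measure (Fin n → ℝ)}, (∀ᵐ x ∂κ, ∀ j, x j ∈ Set.Icc (0 : ℝ) 1) →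
      κ = (κ.map c).map d := fun {κ} hκ => by
    rw [Measure.map_map hd.measurable hc.measurable]
    conv_lhs => rw [← Measure.map_id (μ := κ)]
    refine Measure.map_congr ?_
    filter_upwards [hκ] with x hx
    funext j
    simp [d, c, Set.projIcc_of_mem _ (hx j)]
  have hmoment : ∀ {κ : Measure (Fin n → ℝ)} (a : Fin n → ℕ),
      (∀ᵐ x ∂κ, ∀ j, x j ∈ Set.Icc (0 : ℝ) 1) →
      ∫ y, ∏ j, (y j : ℝ) ^ a j ∂(κ.map c) =
        (∫⁻ x, ∏ j, ENNReal.ofReal (x j) ^ a j ∂κ).toReal := fun {κ} a hκ => by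
    have hcont : Continuous fun y : Fin n → unitInterval => ∏ j, (y j : ℝ) ^ a j := by fun_prop
    rw [integral_map hc.measurable.aemeasurable hcont.aestronglyMeasurable,
      integral_eq_lintegral_of_nonneg_ae
        (ae_of_all _ fun x => Finset.prod_nonneg fun j _ => pow_nonneg (c x j).2.1 _)
        (hcont.comp hc).aestronglyMeasurable]
    congr 1
    refine lintegral_congr_ae ?_
    filter_upwards [hκ] with x hx
    rw [ENNReal.ofReal_prod_of_nonneg fun j _ => pow_nonneg (c x j).2.1 _]
    refine Finset.prod_congr rfl fun j _ => ?_
    rw [ENNReal.ofReal_pow (c x j).2.1]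
    simp [c, Set.projIcc_of_mem _ (hx j)]
  rw [hback hμ, hback hν]
  congr 1
  refine ext_of_integral_eval (p := fun j (y : Fin n → unitInterval) => (y j : ℝ))
    (fun j => by fun_prop) (fun x y hxy => funext fun j => Subtype.ext (hxy j)) fun f => ?_
  have hint : ∀ (κ : Measure (Fin n → unitInterval)) [IsFiniteMeasure κ]
      (f : MvPolynomial (Fin n) ℝ),
      Integrable (fun y => MvPolynomial.eval (fun j => (y j : ℝ)) f) κ := fun κ _ f => by
    have hcont : Continuous fun y : Fin n → unitInterval =>
        MvPolynomial.eval (fun j => (y j : ℝ)) f :=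
      (MvPolynomial.continuous_eval f).comp (by fun_prop)
    rw [← integrableOn_univ]
    exact hcont.continuousOn.integrableOn_compact isCompact_univ
  induction f using MvPolynomial.induction_on' with
  | monomial a r =>
    simp only [MvPolynomial.eval_monomial, Finsupp.prod_fintype _ _ fun _ => pow_zero _,
      integral_const_mul]
    rw [hmoment a hμ, hmoment a hν, h]
  | add f g hf hg =>
    simp only [map_add]
    rw [integral_add (hint _ f) (hint _ g), integral_add (hint _ f) (hint _ g), hf, hg]

/-! ### Moments of the controlling measures -/

lemma isProbabilityMeasure_thomaMeasure (α : simplex) : IsProbabilityMeasure (thomaMeasure α) := by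
  refine ⟨?_⟩
  rw [thomaMeasure, Measure.add_apply, Measure.sum_apply _ MeasurableSet.univ]
  simp only [Measure.smul_apply, measure_univ, smul_eq_mul, mul_one]
  rw [← ENNReal.ofReal_tsum_of_nonneg α.2.2.1 α.2.2.2.1,
    ← ENNReal.ofReal_add (tsum_nonneg α.2.2.1) (gam_nonneg α)]
  simp [gam]

lemma measurable_coord (i : ℕ) : Measurable fun α : simplex => α.1 i :=
  (measurable_pi_apply i).comp measurable_subtype_coe

lemma measurable_gam : Measurable gam := by
  have h : gam = fun α : simplex => 1 - (∑' i, ENNReal.ofReal (α.1 i)).toReal := by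
    funext α
    rw [← ENNReal.ofReal_tsum_of_nonneg α.2.2.1 α.2.2.2.1,
      ENNReal.toReal_ofReal (tsum_nonneg α.2.2.1), gam]
  rw [h]
  exact measurable_const.sub
    (Measurable.tsum fun i => (measurable_coord i).ennreal_ofReal).ennreal_toReal

lemma measurable_thomaMeasure_apply {s : Set ℝ} (hs : MeasurableSet s) :
    Measurable fun α => thomaMeasure α s := by
  simp only [thomaMeasure, Measure.add_apply, Measure.sum_apply _ hs, Measure.smul_apply,
    smul_eq_mul, Measure.dirac_apply' _ hs]
  refine Measurable.add (Measurable.tsum fun i =>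
    (measurable_coord i).ennreal_ofReal.mul ?_) (measurable_gam.ennreal_ofReal.mul_const _)
  exact (measurable_one.indicator hs).comp (measurable_coord i)

/-- Needed for `bind` to be the intended mixture. For probability measures, boxes suffice as a test
family. -/
lemma measurable_pi_thomaMeasure (n : ℕ) :
    Measurable fun α => Measure.pi fun _ : Fin n => thomaMeasure α := by
  have := isProbabilityMeasure_thomaMeasure
  refine Measurable.measure_of_isPiSystem_of_isProbabilityMeasure generateFrom_pi.symm
    isPiSystem_pi ?_
  rintro _ ⟨s, hs, rfl⟩
  simp only [Measure.pi_pi]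
  exact Finset.measurable_prod _ fun j _ => measurable_thomaMeasure_apply (hs j trivial)

lemma lintegral_thomaMeasure_pow (α : simplex) (a : ℕ) :
    ∫⁻ x, ENNReal.ofReal x ^ a ∂(thomaMeasure α) =
      ENNReal.ofReal (extPowerSum α a.succPNat) := by
  rw [thomaMeasure, lintegral_add_measure, lintegral_sum_measure]
  simp only [lintegral_smul_measure, smul_eq_mul]
  have hm : Measurable fun x : ℝ => ENNReal.ofReal x ^ a := by fun_prop
  simp only [lintegral_dirac' _ hm, ← pow_succ']
  have hpow : ∀ i, ENNReal.ofReal (α.1 i) ^ (a + 1) = ENNReal.ofReal (α.1 i ^ (a + 1)) := fun i =>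
    (ENNReal.ofReal_pow (α.2.2.1 i) _).symm
  simp only [hpow]
  have hs := subprob.summable_pow α.2.2 (show 0 < a + 1 by omega)
  have hnn : ∀ i, 0 ≤ α.1 i ^ (a + 1) := fun i => pow_nonneg (α.2.2.1 i) _
  rw [← ENNReal.ofReal_tsum_of_nonneg hnn hs]
  cases a with
  | zero =>
    simp only [pow_zero, mul_one, zero_add, pow_one]
    rw [← ENNReal.ofReal_add (tsum_nonneg α.2.2.1) (gam_nonneg α), extPowerSum,
      if_pos (show Nat.succPNat 0 = 1 from rfl)]
  | succ a =>
    have hk : (a + 1).succPNat ≠ 1 := fun h => by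
      have : a + 1 + 1 = 1 := congrArg PNat.val h
      omega
    rw [extPowerSum_of_ne hk]
    simp

lemma powerSum_succ (a : ℕ) : powerSum (a + 1) = MvPolynomial.X a.succPNat := rfl

lemma lintegral_controllingMeasure {t : ℝ} {P : Measure simplex} (hP : IsPoissonDirichlet t P)
    {n : ℕ} (a : Fin n → ℕ) :
    ∫⁻ x, ∏ j, ENNReal.ofReal (x j) ^ a j ∂(controllingMeasure P n) =
      ENNReal.ofReal (∑ π : Finpartition (Finset.univ : Finset (Fin n)),
        augMoment t (fun B : {B : Finset (Fin n) // B ∈ π.parts} => ∑ j ∈ B.1, (a j + 1))) := by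
  have := hP.isProbabilityMeasure
  have hν := isProbabilityMeasure_thomaMeasure
  have hm : ∀ j, Measurable fun x : ℝ => ENNReal.ofReal x ^ a j := fun j => by fun_prop
  have hprod : Measurable fun x : Fin n → ℝ => ∏ j, ENNReal.ofReal (x j) ^ a j :=
    Finset.measurable_prod _ fun j _ => (hm j).comp (measurable_pi_apply j)
  rw [controllingMeasure,
    Measure.lintegral_bind (measurable_pi_thomaMeasure n).aemeasurable hprod.aemeasurable,
    ← hP.integral_prod_powerSum (fun j => Nat.succ_pos (a j)),
    ofReal_integral_eq_lintegral_ofReal (integrable_specialize P _)]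
  · refine lintegral_congr fun α => ?_
    rw [ProbabilityTheory.lintegral_prod_eq_prod_lintegral_of_indepFun Finset.univ
      (fun j (x : Fin n → ℝ) => ENNReal.ofReal (x j) ^ a j)
      (ProbabilityTheory.iIndepFun_pi fun j => (hm j).aemeasurable)
      fun j => (hm j).comp (measurable_pi_apply j)]
    simp only [specialize, map_prod, powerSum_succ, MvPolynomial.aeval_X]
    rw [ENNReal.ofReal_prod_of_nonneg fun j _ => extPowerSum_nonneg α _]
    refine Finset.prod_congr rfl fun j _ => ?_
    rw [← lintegral_thomaMeasure_pow]
    exact (measurePreserving_eval (fun _ : Fin n => thomaMeasure α) j).lintegral_comp (hm j)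
  · refine ae_of_all _ fun α => ?_
    simp only [specialize, map_prod, powerSum_succ, MvPolynomial.aeval_X]
    exact Finset.prod_nonneg fun j _ => extPowerSum_nonneg α _

lemma isProbabilityMeasure_controllingMeasure (P : Measure simplex) [IsProbabilityMeasure P]
    (n : ℕ) : IsProbabilityMeasure (controllingMeasure P n) := by
  have hν := isProbabilityMeasure_thomaMeasure
  refine ⟨?_⟩
  rw [controllingMeasure, Measure.bind_apply MeasurableSet.univ
    (measurable_pi_thomaMeasure n).aemeasurable]
  simp

lemma thomaMeasure_compl_Icc (α : simplex) : thomaMeasure α (Set.Icc 0 1)ᶜ = 0 := by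
  have hs : MeasurableSet (Set.Icc (0 : ℝ) 1)ᶜ := measurableSet_Icc.compl
  rw [thomaMeasure, Measure.add_apply, Measure.sum_apply _ hs]
  simp [Measure.dirac_apply' _ hs, α.2.2.1, subprob.le_one α.2.2]

lemma ae_controllingMeasure_mem_Icc (P : Measure simplex) (n : ℕ) :
    ∀ᵐ x ∂(controllingMeasure P n), ∀ j, x j ∈ Set.Icc (0 : ℝ) 1 := by
  have hν := isProbabilityMeasure_thomaMeasure
  rw [ae_all_iff]
  intro j
  have hs : MeasurableSet ((fun x : Fin n → ℝ => x j) ⁻¹' (Set.Icc (0 : ℝ) 1)ᶜ) :=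
    measurable_pi_apply j measurableSet_Icc.compl
  change controllingMeasure P n ((fun x : Fin n → ℝ => x j) ⁻¹' (Set.Icc (0 : ℝ) 1)ᶜ) = 0
  rw [controllingMeasure, Measure.bind_apply hs (measurable_pi_thomaMeasure n).aemeasurable]
  refine lintegral_eq_zero_of_ae_eq_zero (ae_of_all _ fun α => ?_)
  exact Measure.pi_eval_preimage_null _ (thomaMeasure_compl_Icc α)

/-! ### Dirichlet integrals -/

lemma measurable_posPow (s : ℝ) : Measurable fun u => posPow u s :=
  Measurable.ite measurableSet_Ioi (by fun_prop) measurable_const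

lemma lintegral_pow_mul_posPow {c s : ℝ} (hc : c ≤ 1) (hs : 0 < s) (m : ℕ) :
    ∫⁻ y in Set.Icc (0 : ℝ) 1, ENNReal.ofReal (y ^ m * posPow (c - y) (s - 1)) =
      ENNReal.ofReal (ProbabilityTheory.beta (m + 1) s * posPow c (s + (m + 1) - 1)) := by
  rcases le_or_gt c 0 with h0 | h0
  · rw [posPow, if_neg h0.not_gt, mul_zero, ENNReal.ofReal_zero]
    rw [setLIntegral_congr_fun measurableSet_Icc (g := fun _ => 0)]
    · simp
    · intro y hy
      have : ¬ 0 < c - y := by have := hy.1; linarith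
      simp [posPow, this]
  · have h1 : ∫⁻ y in Set.Icc (0 : ℝ) 1, ENNReal.ofReal (y ^ m * posPow (c - y) (s - 1)) =
        ∫⁻ y, (Set.Ioo 0 c).indicator
          (fun y => ENNReal.ofReal (y ^ m * (c - y) ^ (s - 1))) y := by
      rw [← lintegral_indicator measurableSet_Icc]
      -- At `y = 0` the integrands on the closed and open intervals can differ when `m = 0`.
      have h0' : ∀ᵐ y : ℝ, y ≠ 0 := by simp [ae_iff]
      refine lintegral_congr_ae ?_
      filter_upwards [h0'] with y hy
      simp only [Set.indicator, Set.mem_Icc, Set.mem_Ioo]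
      by_cases hy' : 0 < y ∧ y < c
      · rw [if_pos hy', if_pos ⟨hy'.1.le, (hy'.2.trans_le hc).le⟩, posPow,
          if_pos (sub_pos.2 hy'.2)]
      · rw [if_neg hy']
        split_ifs with hI
        · have : ¬ 0 < c - y := fun h =>
            hy' ⟨lt_of_le_of_ne hI.1 hy.symm, sub_pos.1 h⟩
          simp [posPow, this]
        · rfl
    have hmeas : Measurable ((Set.Ioo 0 c).indicator
        (fun y => ENNReal.ofReal (y ^ m * (c - y) ^ (s - 1)))) :=
      Measurable.indicator (by fun_prop) measurableSet_Ioo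
    rw [h1, ← Real.smul_map_volume_mul_left h0.ne', lintegral_smul_measure,
      lintegral_map hmeas (measurable_const_mul c), posPow, if_pos h0, mul_comm,
      ENNReal.ofReal_mul (Real.rpow_nonneg h0.le _),
      ← lintegral_Ioo_rpow_mul_rpow (by positivity) hs,
      ← lintegral_const_mul' _ _ ENNReal.ofReal_ne_top,
      ← lintegral_indicator measurableSet_Ioo, smul_eq_mul,
      ← lintegral_const_mul' _ _ ENNReal.ofReal_ne_top]
    refine lintegral_congr fun x => ?_
    simp only [Set.indicator, Set.mem_Ioo]
    by_cases hx : 0 < x ∧ x < 1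
    · have hx' : 0 < c * x ∧ c * x < c := ⟨mul_pos h0 hx.1, by nlinarith [hx.2]⟩
      have h1x : 0 < 1 - x := sub_pos.2 hx.2
      rw [if_pos hx, if_pos hx', abs_of_pos h0, ← ENNReal.ofReal_mul h0.le,
        ← ENNReal.ofReal_mul (Real.rpow_nonneg h0.le _)]
      congr 1
      rw [show c - c * x = c * (1 - x) by ring, Real.mul_rpow h0.le h1x.le, mul_pow,
        add_sub_cancel_right, Real.rpow_natCast,
        show s + (m + 1) - 1 = (s - 1) + m + 1 by ring, Real.rpow_add h0, Real.rpow_add h0,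
        Real.rpow_one, Real.rpow_natCast]
      ring
    · have hx' : ¬ (0 < c * x ∧ c * x < c) := fun h =>
        hx ⟨by nlinarith [h.1], by nlinarith [h.2]⟩
      rw [if_neg hx, if_neg hx', mul_zero]

lemma volume_restrict_Icc_pi (r : ℕ) :
    (volume : Measure (Fin r → ℝ)).restrict (Set.Icc 0 1) =
      Measure.pi fun _ : Fin r => (volume : Measure ℝ).restrict (Set.Icc 0 1) := by
  rw [← Set.pi_univ_Icc, volume_pi, Measure.restrict_pi_pi]
  rfl

lemma ae_pi_restrict_mem_Icc (r : ℕ) :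
    ∀ᵐ y ∂(Measure.pi fun _ : Fin r => (volume : Measure ℝ).restrict (Set.Icc 0 1)),
      ∀ i, y i ∈ Set.Icc (0 : ℝ) 1 := by
  rw [← volume_restrict_Icc_pi]
  filter_upwards [ae_restrict_mem measurableSet_Icc] with y hy i
  exact ⟨hy.1 i, hy.2 i⟩

/-- The Dirichlet integral. -/
lemma lintegral_prod_pow_mul_posPow (r : ℕ) : ∀ (c : Fin r → ℕ) {s : ℝ}, 0 < s →
    ∫⁻ y, ENNReal.ofReal ((∏ i, y i ^ c i) * posPow (1 - ∑ i, y i) (s - 1))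
      ∂(Measure.pi fun _ : Fin r => (volume : Measure ℝ).restrict (Set.Icc 0 1)) =
    ENNReal.ofReal ((∏ i, ((c i).factorial : ℝ)) * Real.Gamma s /
      Real.Gamma (s + (∑ i, (c i + 1) : ℕ))) := by
  induction r with
  | zero =>
    intro c s hs
    rw [Measure.pi_of_empty, lintegral_dirac]
    simp [posPow, (Real.Gamma_pos_of_pos hs).ne']
  | succ r ih =>
    intro c s hs
    have hmp := (measurePreserving_piFinSuccAbove
      (fun _ : Fin (r + 1) => (volume : Measure ℝ).restrict (Set.Icc 0 1)) 0).symm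
    have hg : Measurable fun y : Fin (r + 1) → ℝ =>
        ENNReal.ofReal ((∏ i, y i ^ c i) * posPow (1 - ∑ i, y i) (s - 1)) := by
      have := measurable_posPow (s - 1)
      fun_prop
    have hsplit : ∀ p : ℝ × (Fin r → ℝ),
        (MeasurableEquiv.piFinSuccAbove (fun _ : Fin (r + 1) => ℝ) 0).symm p = Fin.cons p.1 p.2 :=
      fun p => by
        simp only [MeasurableEquiv.piFinSuccAbove_symm_apply]
        exact Fin.insertNth_zero' _ _
    have hg' : Measurable fun p : ℝ × (Fin r → ℝ) => ENNReal.ofReal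
        ((∏ i, (MeasurableEquiv.piFinSuccAbove (fun _ => ℝ) 0).symm p i ^ c i) *
          posPow (1 - ∑ i, (MeasurableEquiv.piFinSuccAbove (fun _ => ℝ) 0).symm p i) (s - 1)) :=
      hg.comp hmp.measurable
    rw [← hmp.lintegral_comp hg, lintegral_prod_symm _ hg'.aemeasurable]
    have hβ := ProbabilityTheory.beta_pos (show (0 : ℝ) < c 0 + 1 by positivity) hs
    -- Integrating out the first variable, with the slack left by the others as `c`, raises `s` to
    -- `s + c 0 + 1`; hence the induction over all `s`.
    calc _ = ∫⁻ y, ENNReal.ofReal (ProbabilityTheory.beta (c 0 + 1) s) *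
          ENNReal.ofReal ((∏ i, y i ^ c i.succ) *
            posPow (1 - ∑ i, y i) (s + (c 0 + 1) - 1))
          ∂(Measure.pi fun _ : Fin r => (volume : Measure ℝ).restrict (Set.Icc 0 1)) := by
          refine lintegral_congr_ae ?_
          filter_upwards [ae_pi_restrict_mem_Icc r] with y hy
          have hprod : 0 ≤ ∏ i, y i ^ c i.succ :=
            Finset.prod_nonneg fun i _ => pow_nonneg (hy i).1 _
          have hle : 1 - ∑ i, y i ≤ 1 :=
            sub_le_self _ (Finset.sum_nonneg fun i _ => (hy i).1)
          calc _ = ∫⁻ x in Set.Icc (0 : ℝ) 1, ENNReal.ofReal (∏ i, y i ^ c i.succ) *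
                ENNReal.ofReal (x ^ c 0 * posPow ((1 - ∑ i, y i) - x) (s - 1)) := by
                refine lintegral_congr fun x => ?_
                rw [hsplit, Fin.prod_univ_succ, Fin.sum_univ_succ, ← ENNReal.ofReal_mul hprod]
                simp only [Fin.cons_zero, Fin.cons_succ]
                congr 1
                rw [show 1 - (x + ∑ i, y i) = 1 - ∑ i, y i - x by ring]
                ring
            _ = _ := by
                rw [lintegral_const_mul' _ _ ENNReal.ofReal_ne_top,
                  lintegral_pow_mul_posPow hle hs, ← ENNReal.ofReal_mul hprod,
                  ← ENNReal.ofReal_mul hβ.le]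
                congr 1
                ring
      _ = _ := by
          rw [lintegral_const_mul' _ _ ENNReal.ofReal_ne_top,
            ih (fun i => c i.succ) (show 0 < s + (c 0 + 1) by positivity),
            ← ENNReal.ofReal_mul hβ.le]
          congr 1
          rw [ProbabilityTheory.beta, Real.Gamma_nat_eq_factorial, Fin.prod_univ_succ,
            Fin.sum_univ_succ, add_comm ((c 0 : ℝ) + 1) s]
          have h1 := (Real.Gamma_pos_of_pos (show 0 < s + ((c 0 : ℝ) + 1) by positivity)).ne'
          push_cast
          rw [add_assoc s]
          field_simp

/-! ### Moments of the section measures -/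

section Section

variable {n r : ℕ} {π : SetPartition n r}

lemma measurable_section (e : π.Enumeration) :
    Measurable fun (y : Fin r → ℝ) j => y (SetPartition.blockIndex e j) :=
  measurable_pi_lambda _ fun _ => measurable_pi_apply _

lemma ae_sectionMeasure_mem_Icc (t : ℝ) (e : π.Enumeration) :
    ∀ᵐ x ∂(sectionMeasure t e), ∀ j, x j ∈ Set.Icc (0 : ℝ) 1 := by
  have hs : MeasurableSet {x : Fin n → ℝ | ∀ j, x j ∈ Set.Icc (0 : ℝ) 1} := by
    simp only [Set.ofPred_forall]
    exact MeasurableSet.iInter fun j => measurable_pi_apply j measurableSet_Icc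
  rw [sectionMeasure, ae_map_iff (measurable_section e).aemeasurable hs]
  refine (withDensity_absolutelyContinuous _ _).ae_le ?_
  filter_upwards [ae_restrict_mem measurableSet_Icc] with y hy j
  exact ⟨hy.1 _, hy.2 _⟩

lemma prod_comp_blockIndex {M : Type*} [CommMonoid M] (e : π.Enumeration) (y : Fin r → M)
    (a : Fin n → ℕ) :
    ∏ j, y (SetPartition.blockIndex e j) ^ a j = ∏ i, y i ^ ∑ j ∈ (e i).1, a j := by
  rw [← Equiv.prod_comp e.symm]
  simp only [Equiv.apply_symm_apply]
  exact prod_comp_block π.1 (fun B => y (e.symm B)) a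

/-- The density gives block `i` the exponent `|πᵢ| - 1` and the monomial adds `∑ aⱼ`; together they
make `∑ (aⱼ + 1) - 1`, the index of the factorial in `augMoment`. -/
lemma lintegral_sectionMeasure {t : ℝ} (ht : 0 < t) (e : π.Enumeration) (a : Fin n → ℕ) :
    ∫⁻ x, ∏ j, ENNReal.ofReal (x j) ^ a j ∂(sectionMeasure t e) =
      ENNReal.ofReal (augMoment t
        (fun B : {B : Finset (Fin n) // B ∈ π.1.parts} => ∑ j ∈ B.1, (a j + 1))) := by
  have hprod : Measurable fun x : Fin n → ℝ => ∏ j, ENNReal.ofReal (x j) ^ a j := by fun_prop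
  have hdens : Measurable fun y : Fin r → ℝ => ENNReal.ofReal
      (t ^ r * (∏ i, y i ^ ((e i).1.card - 1)) * posPow (1 - ∑ i, y i) (t - 1)) := by
    have := measurable_posPow (t - 1)
    fun_prop
  have hexp : ∀ i, ∑ j ∈ (e i).1, (a j + 1) = (e i).1.card - 1 + ∑ j ∈ (e i).1, a j + 1 := by
    intro i
    have : 0 < (e i).1.card := (π.1.nonempty_of_mem_parts (e i).2).card_pos
    rw [Finset.sum_add_distrib, Finset.sum_const, smul_eq_mul, mul_one]
    omega
  let c : Fin r → ℕ := fun i => (e i).1.card - 1 + ∑ j ∈ (e i).1, a j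
  have hprod' : Measurable fun y : Fin r → ℝ =>
      ∏ j, ENNReal.ofReal (y (SetPartition.blockIndex e j)) ^ a j :=
    hprod.comp (measurable_section e)
  rw [sectionMeasure, lintegral_map hprod (measurable_section e), dirichletTypeMeasure,
    lintegral_withDensity_eq_lintegral_mul _ hdens hprod',
    volume_restrict_Icc_pi]
  calc _ = ∫⁻ y, ENNReal.ofReal (t ^ r) *
        ENNReal.ofReal ((∏ i, y i ^ c i) * posPow (1 - ∑ i, y i) (t - 1))
        ∂(Measure.pi fun _ : Fin r => (volume : Measure ℝ).restrict (Set.Icc 0 1)) := by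
        refine lintegral_congr_ae ?_
        filter_upwards [ae_pi_restrict_mem_Icc r] with y hy
        simp only [Pi.mul_apply]
        rw [prod_comp_blockIndex e (fun i => ENNReal.ofReal (y i)) a,
          Finset.prod_congr rfl fun i _ => (ENNReal.ofReal_pow (hy i).1 _).symm,
          ← ENNReal.ofReal_prod_of_nonneg fun i _ => pow_nonneg (hy i).1 _,
          ← ENNReal.ofReal_mul' (Finset.prod_nonneg fun i _ => pow_nonneg (hy i).1 _),
          ← ENNReal.ofReal_mul (by positivity)]
        congr 1
        simp only [c, pow_add, Finset.prod_mul_distrib]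
        ring
    _ = _ := by
        rw [lintegral_const_mul' _ _ ENNReal.ofReal_ne_top, lintegral_prod_pow_mul_posPow r c ht,
          ← ENNReal.ofReal_mul (by positivity)]
        congr 1
        have hcard : Fintype.card {B : Finset (Fin n) // B ∈ π.1.parts} = r := by
          rw [← Fintype.card_congr e, Fintype.card_fin]
        have hfac : ∏ B : {B : Finset (Fin n) // B ∈ π.1.parts},
            ((∑ j ∈ B.1, (a j + 1) - 1).factorial : ℝ) = ∏ i, ((c i).factorial : ℝ) := by
          rw [← Equiv.prod_comp e]
          exact Finset.prod_congr rfl fun i _ => by rw [hexp, Nat.add_sub_cancel]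
        have hsum : ∑ B : {B : Finset (Fin n) // B ∈ π.1.parts}, ∑ j ∈ B.1, (a j + 1) =
            ∑ i, (c i + 1) := by
          rw [← Equiv.sum_comp e]
          exact Finset.sum_congr rfl fun i _ => hexp i
        rw [augMoment, hcard, hfac, hsum, ← ascPochhammer_eval_mul_Gamma ht]
        have h1 := (Real.Gamma_pos_of_pos ht).ne'
        have h2 := (ascPochhammer_eval_pos ht (∑ i, (c i + 1))).ne'
        field_simp

end Section

/-! ### Comparison of moments, partition by partition. -/

lemma augMoment_nonneg {ι : Type*} [Fintype ι] {t : ℝ} (ht : 0 < t) (k : ι → ℕ) :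
    0 ≤ augMoment t k := by
  have := ascPochhammer_eval_pos ht (∑ i, k i)
  unfold augMoment
  positivity

lemma sum_finpartition_eq {M : Type*} [AddCommMonoid M] {n : ℕ} (hn : 1 ≤ n)
    (G : Finpartition (Finset.univ : Finset (Fin n)) → M) :
    ∑ π, G π = ∑ r ∈ Finset.Icc 1 n, ∑ π : SetPartition n r, G π.1 := by
  rw [← Finset.sum_fiberwise_of_maps_to (t := Finset.Icc 1 n) (g := fun π => π.parts.card)]
  · refine Finset.sum_congr rfl fun r _ => ?_
    exact Finset.sum_subtype _ (by simp) G
  · intro π _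
    have : Nonempty (Fin n) := ⟨⟨0, hn⟩⟩
    have h1 := (π.parts_nonempty (Finset.univ_nonempty.ne_empty)).card_pos
    have h2 := π.card_parts_le_card
    rw [Finset.card_univ, Fintype.card_fin] at h2
    exact Finset.mem_Icc.2 ⟨h1, h2⟩

lemma controllingMeasure_eq {t : ℝ} (ht : 0 < t) {P : Measure simplex}
    (hP : IsPoissonDirichlet t P) {n : ℕ} (hn : 1 ≤ n)
    (e : ∀ (r : ℕ) (π : SetPartition n r), π.Enumeration) :
    controllingMeasure P n =
      ∑ r ∈ Finset.Icc 1 n, ∑ π : SetPartition n r, sectionMeasure t (e r π) := by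
  have := hP.isProbabilityMeasure
  have := isProbabilityMeasure_controllingMeasure P n
  refine ext_of_lintegral_prod_pow (ae_controllingMeasure_mem_Icc P n) ?_ fun a => ?_
  · rw [ae_iff]
    simp only [Measure.coe_finsetSum, Finset.sum_apply]
    exact Finset.sum_eq_zero fun r _ => Finset.sum_eq_zero fun π _ =>
      ae_iff.1 (ae_sectionMeasure_mem_Icc t (e r π))
  · rw [lintegral_controllingMeasure hP,
      ENNReal.ofReal_sum_of_nonneg fun π _ => augMoment_nonneg ht _, sum_finpartition_eq hn]
    simp only [lintegral_finsetSum_measure, lintegral_sectionMeasure ht]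

end PoissonDirichlet

theorem theorem7p1 (t : ℝ) (ht : 0 < t) :
    (∃! P : MeasureTheory.Measure PoissonDirichlet.simplex,
      PoissonDirichlet.IsPoissonDirichlet t P) ∧
    ∀ P : MeasureTheory.Measure PoissonDirichlet.simplex,
      PoissonDirichlet.IsPoissonDirichlet t P →
      ∀ n : ℕ, 1 ≤ n →
      ∀ e : (∀ (r : ℕ) (π : PoissonDirichlet.SetPartition n r), π.Enumeration),
        PoissonDirichlet.controllingMeasure P n =
          ∑ r ∈ Finset.Icc 1 n, ∑ π : PoissonDirichlet.SetPartition n r,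
            PoissonDirichlet.sectionMeasure t (e r π) := by
  refine ⟨?_, fun P hP n hn e => PoissonDirichlet.controllingMeasure_eq ht hP hn e⟩
  obtain ⟨P, hP⟩ := PoissonDirichlet.exists_isPoissonDirichlet ht
  exact ⟨P, hP, fun Q hQ => hQ.unique hP⟩
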